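/- **Conventions.** Let $\mathbb K\in\{\mathbb R,\mathbb C\}$; locally convex spaces are Hausdorff. A *continuous inverse algebra* over $\mathbb K$ is a unital associative $\mathbb K$-algebra $A$ with a locally convex vector topology such that multiplication $A\times A\to A$ is continuous, the unit group $A^\times$ is open in $A$, and the inversion map $A^\times\to A$, $x\mapsto x^{-1}$ is continuous. A locally convex space $E$ is *Mackey-complete* if every Lipschitz curve $\gamma\colon[0,1]\to E$ (that is, every $\gamma$ for which $\{\frac{\gamma(t)-\gamma(s)}{t-s}: s\neq t\}$ is bounded in $E$) has a Riemann integral in $E$. A map $f\colon U\to F$ from an open subset $U$ of a real locally convex space $E$ to a real locally convex space $F$ is *smooth* if it is continuous and, for every $k\ge 1$, the iterated directional derivatives $d^{(k)}f(x,y_1,\dots,y_k)=(D_{y_k}\cdots D_{y_1}f)(x)$ exist and define a continuous map $U\times E^k\to F$; complex locally convex spaces are regarded as real ones. Lie groups modelled on a locally convex space are understood with respect to this notion of smoothness. A Lie group $G$ modelled on a locally convex space, with Lie algebra $\mathfrak g=T_1G$, is *regular in Milnor's sense* if for each $\gamma\in C^\infty([0,1],\mathfrak g)$ there is a (necessarily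 unique) $C^1$-map $\eta_\gamma\colon[0,1]\to G$ with $\eta_\gamma(0)=1$ and $\eta_\gamma'(t)=\eta_\gamma(t)\gamma(t):=T_1(\lambda_{\eta_\gamma(t)})(\gamma(t))$ for all $t\in[0,1]$, where $\lambda_g(x)=gx$, and the map $C^\infty([0,1],\mathfrak g)\to G$, $\gamma\mapsto\eta_\gamma(1)$ is smooth. Here $C^\infty([0,1],\mathfrak g)$ carries the locally convex topology defined by the seminorms $\gamma\mapsto\max_{j\le k}\max_{t\in[0,1]}p(\gamma^{(j)}(t))$, with $k\in\mathbb N_0$ and $p$ a continuous seminorm on $\mathfrak g$. **Theorem.** Let $A$ be a Mackey-complete continuous inverse algebra over $\mathbb K$ which satisfies the following condition: $(*)$ For each continuous seminorm $p$ on $A$ there exist a continuous seminorm $q$ on $A$ and $r>0$ (which may depend on $p$ and $q$) such that $$\sum_{n=1}^\infty r^n\,\|\mu_n\|_{p,q}<\infty,\qquad \|\mu_n\|_{p,q}:=\sup\{p(x_1x_2\cdots x_n): x_1,\dots,x_n\in A,\ q(x_1)\le 1,\dots,q(x_n)\le 1\}\in[0,\infty].$$ Then the group $A^\times$ of invertible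 elements of $A$, regarded as an open submanifold of $A$, is a Lie group modelled on $A$ which is regular in Milnor's sense. -/

import Mathlib

open Set Filter Topology
open scoped unitInterval ENNReal

set_option linter.unusedSectionVars false

/-! ### Differential calculus in locally convex spaces -/

section Calculus

variable {E F : Type*} [AddCommGroup E] [Module ℝ E] [TopologicalSpace E]
  [AddCommGroup F] [Module ℝ F] [TopologicalSpace F]

/-- `v` is the directional derivative `(D_y f)(x)`, i.e. the limit of `(f (x + h y) - f x) / h`
as `h → 0`. -/
def HasDirDerivAt (f : E → F) (v : F) (x y : E) : Prop :=
  Tendsto (fun h : ℝ => h⁻¹ • (f (x + h • y) - f x)) (𝓝[≠] 0) (𝓝 v)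

/-- `f` is smooth (`C^∞`) on the open set `U`: `f` is continuous there, all iterated directional
derivatives `d k x (y₁, …, y_k) = (D_{y_k} ⋯ D_{y₁} f)(x)` exist for `x ∈ U` and
`y₁, …, y_k ∈ E`, and they are continuous functions on `U × E^k`. -/
def SmoothOnOpen (f : E → F) (U : Set E) : Prop :=
  ∃ d : (k : ℕ) → E → (Fin k → E) → F,
    (∀ x ∈ U, ∀ y, d 0 x y = f x) ∧
    (∀ k, ∀ x ∈ U, ∀ y : Fin (k + 1) → E,
      HasDirDerivAt (fun z => d k z (Fin.init y)) (d (k + 1) x y) x (y (Fin.last k))) ∧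
    (∀ k, ContinuousOn (fun z : E × (Fin k → E) => d k z.1 z.2) (U ×ˢ univ))

/-- `v` is the derivative at `t` of the curve `γ` on `[0,1]` (one-sided at the end points). -/
def HasCurveDerivAt (γ : I → E) (v : E) (t : I) : Prop :=
  Tendsto (fun s : I => ((s : ℝ) - (t : ℝ))⁻¹ • (γ s - γ t)) (𝓝[≠] t) (𝓝 v)

/-- `g k` is the `k`-th derivative of the continuous curve `γ`, for every `k`. -/
def IsDerivSeq (γ : C(I, E)) (g : ℕ → C(I, E)) : Prop :=
  g 0 = γ ∧ ∀ k t, HasCurveDerivAt (g k) (g (k + 1) t) t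

end Calculus

/-! ### The space `C^∞([0,1], E)` -/

section SmoothCurves

variable (E : Type*) [AddCommGroup E] [Module ℝ E] [TopologicalSpace E]
  [IsTopologicalAddGroup E] [ContinuousSMul ℝ E]

variable {E} in
theorem IsDerivSeq.add {γ δ : C(I, E)} {g h : ℕ → C(I, E)} (hg : IsDerivSeq γ g)
    (hh : IsDerivSeq δ h) : IsDerivSeq (γ + δ) (g + h) := by
  refine ⟨by simp [hg.1, hh.1], fun k t => ?_⟩
  have := (hg.2 k t).add (hh.2 k t)
  refine this.congr fun s => ?_
  simp only [Pi.add_apply, ContinuousMap.add_apply]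
  rw [← smul_add]
  congr 1
  abel

variable {E} in
theorem IsDerivSeq.smul (c : ℝ) {γ : C(I, E)} {g : ℕ → C(I, E)} (hg : IsDerivSeq γ g) :
    IsDerivSeq (c • γ) (c • g) := by
  refine ⟨by simp [hg.1], fun k t => ?_⟩
  have := (hg.2 k t).const_smul c
  refine this.congr fun s => ?_
  simp only [Pi.smul_apply, ContinuousMap.smul_apply]
  rw [smul_comm, smul_sub]

variable {E} in
theorem IsDerivSeq.unique [T2Space E] {γ : C(I, E)} {g h : ℕ → C(I, E)} (hg : IsDerivSeq γ g)
    (hh : IsDerivSeq γ h) : g = h := by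
  funext k
  induction k with
  | zero => rw [hg.1, hh.1]
  | succ k ih =>
    ext t
    have hne : (𝓝[≠] t).NeBot := inferInstance
    have h1 := hg.2 k t
    rw [ih] at h1
    exact tendsto_nhds_unique h1 (hh.2 k t)

/-- The vector space of smooth curves `[0,1] → E`. -/
def smoothCurves : Submodule ℝ C(I, E) where
  carrier := {γ | ∃ g, IsDerivSeq γ g}
  zero_mem' := by
    refine ⟨0, rfl, fun k t => ?_⟩
    simpa [HasCurveDerivAt] using tendsto_const_nhds
  add_mem' := by
    rintro γ δ ⟨g, hg⟩ ⟨h, hh⟩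
    exact ⟨_, hg.add hh⟩
  smul_mem' := by
    rintro c γ ⟨g, hg⟩
    exact ⟨_, hg.smul c⟩

/-- The space `C^∞([0,1], E)`; its topology is defined below. -/
def SmoothCurve : Type _ := smoothCurves E

noncomputable instance : AddCommGroup (SmoothCurve E) :=
  inferInstanceAs (AddCommGroup (smoothCurves E))

noncomputable instance : Module ℝ (SmoothCurve E) :=
  inferInstanceAs (Module ℝ (smoothCurves E))

variable {E}

/-- The underlying continuous curve. -/
def SmoothCurve.toCurve (γ : SmoothCurve E) : C(I, E) := γ.1

/-- The `k`-th derivative of a smooth curve, as a continuous curve. -/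
noncomputable def SmoothCurve.iterDeriv (γ : SmoothCurve E) : ℕ → C(I, E) := γ.2.choose

theorem SmoothCurve.isDerivSeq (γ : SmoothCurve E) : IsDerivSeq γ.toCurve γ.iterDeriv :=
  γ.2.choose_spec

/-- The locally convex topology on `C^∞([0,1], E)` given by uniform convergence of each
derivative, i.e. by the seminorms `max_{j ≤ k} max_t p (γ^(j) t)` with `k ∈ ℕ` and `p` a continuous
seminorm on `E` (the topology on `C(I, E)` is that of uniform convergence). -/
noncomputable instance : TopologicalSpace (SmoothCurve E) :=
  TopologicalSpace.induced SmoothCurve.iterDeriv inferInstance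

/-- Passing to all derivatives, as a linear map. -/
noncomputable def SmoothCurve.iterDerivₗ [T2Space E] : SmoothCurve E →ₗ[ℝ] (ℕ → C(I, E)) where
  toFun := SmoothCurve.iterDeriv
  map_add' γ δ := (γ + δ).isDerivSeq.unique (γ.isDerivSeq.add δ.isDerivSeq)
  map_smul' c γ := (c • γ).isDerivSeq.unique (γ.isDerivSeq.smul c)

instance [T2Space E] : IsTopologicalAddGroup (SmoothCurve E) :=
  topologicalAddGroup_induced (SmoothCurve.iterDerivₗ (E := E))

instance [T2Space E] : ContinuousSMul ℝ (SmoothCurve E) :=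
  continuousSMul_induced (SmoothCurve.iterDerivₗ (E := E))

instance [T2Space E] [LocallyConvexSpace ℝ E] : LocallyConvexSpace ℝ (SmoothCurve E) :=
  LocallyConvexSpace.induced (SmoothCurve.iterDerivₗ (E := E))

end SmoothCurves

/-! ### Mackey-completeness -/

section Mackey

variable {E : Type*} [AddCommGroup E] [Module ℝ E] [TopologicalSpace E]

/-- A curve on `[0,1]` is Lipschitz if its difference quotients form a bounded set. -/
def IsLipschitzCurve (γ : I → E) : Prop :=
  Bornology.IsVonNBounded ℝ
    {v : E | ∃ s t : I, s ≠ t ∧ v = ((t : ℝ) - (s : ℝ))⁻¹ • (γ t - γ s)}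

/-- `J` is the Riemann integral of `γ` over `[0,1]`: the Riemann sums over the partitions
`0 = x 0 ≤ x 1 ≤ ⋯ ≤ x n = 1` with tags `ξ i ∈ [x i, x (i + 1)]` tend to `J` as the mesh tends
to `0`. -/
def HasRiemannIntegral (γ : I → E) (J : E) : Prop :=
  ∀ U ∈ 𝓝 J, ∃ δ : ℝ, 0 < δ ∧ ∀ (n : ℕ) (x ξ : ℕ → I), x 0 = 0 → x n = 1 →
    (∀ i < n, x i ≤ ξ i ∧ ξ i ≤ x (i + 1) ∧ (x (i + 1) : ℝ) - (x i : ℝ) < δ) →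
    ∑ i ∈ Finset.range n, ((x (i + 1) : ℝ) - (x i : ℝ)) • γ (ξ i) ∈ U

variable (E) in
/-- A locally convex space is Mackey-complete if every Lipschitz curve has a Riemann integral. -/
def IsMackeyComplete : Prop :=
  ∀ γ : I → E, IsLipschitzCurve γ → ∃ J : E, HasRiemannIntegral γ J

end Mackey

/-! ### Lie groups modelled on locally convex spaces, and Milnor regularity -/

section LieGroup

variable (E G : Type*) [AddCommGroup E] [Module ℝ E] [TopologicalSpace E]
  [IsTopologicalAddGroup E] [ContinuousSMul ℝ E] [LocallyConvexSpace ℝ E] [T2Space E]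
  [Group G] [TopologicalSpace G] [ChartedSpace E G]

/-- The group `G`, with the given atlas, is a (smooth, Hausdorff) Lie group modelled on the locally
convex space `E`: chart changes, multiplication and inversion are smooth. -/
structure IsLCLieGroup : Prop extends IsTopologicalGroup G, T2Space G where
  smooth_chart_change : ∀ e ∈ atlas E G, ∀ e' ∈ atlas E G,
    SmoothOnOpen (fun x => e' (e.symm x)) {x | x ∈ e.target ∧ e.symm x ∈ e'.source}
  smooth_mul : ∀ e₁ ∈ atlas E G, ∀ e₂ ∈ atlas E G, ∀ e₃ ∈ atlas E G,
    SmoothOnOpen (fun z : E × E => e₃ (e₁.symm z.1 * e₂.symm z.2))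
      {z | z.1 ∈ e₁.target ∧ z.2 ∈ e₂.target ∧ e₁.symm z.1 * e₂.symm z.2 ∈ e₃.source}
  smooth_inv : ∀ e ∈ atlas E G, ∀ e' ∈ atlas E G,
    SmoothOnOpen (fun x => e' (e.symm x)⁻¹) {x | x ∈ e.target ∧ (e.symm x)⁻¹ ∈ e'.source}

variable {G}

/-- The curve `η : [0,1] → G` is `C^1`: it is continuous and is `C^1` in each chart. -/
def IsC1Curve (η : I → G) : Prop :=
  Continuous η ∧ ∀ e ∈ atlas E G, ∃ v : I → E, ContinuousOn v (η ⁻¹' e.source) ∧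
    ∀ t, η t ∈ e.source → HasCurveDerivAt (fun s => e (η s)) (v t) t

variable {E}

/-- For `g ∈ G` and `v ∈ T_1 G`, the tangent vector `g v = T_1(λ_g)(v) ∈ T_g G` is `w`.
Here `T_h G` is identified with `E` by means of the chart `chartAt E h` (for `h = 1` and
`h = g`). -/
def IsLeftTranslate (g : G) (v w : E) : Prop :=
  HasDirDerivAt (fun x : E => chartAt E g (g * (chartAt E (1 : G)).symm x)) w
    (chartAt E (1 : G) 1) v

/-- `η` is an evolution of `γ : [0,1] → T_1 G ≅ E`: `η` is `C^1`, `η 0 = 1` and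
`η'(t) = η(t) γ(t)` in `T_{η(t)} G` for all `t`; the tangent space `T_{η(t)} G` is identified
with `E` by means of the chart at `η t`. -/
structure IsEvolution (γ : I → E) (η : I → G) : Prop where
  isC1 : IsC1Curve E η
  init : η 0 = 1
  deriv_eq : ∀ t, ∃ w : E, HasCurveDerivAt (fun s => chartAt E (η t) (η s)) w t ∧
    IsLeftTranslate (η t) (γ t) w

/-- A map from (all of) a locally convex space `V` to the Lie group `G` is smooth. -/
def IsSmoothMapInto {V : Type*} [AddCommGroup V] [Module ℝ V] [TopologicalSpace V]
    (f : V → G) : Prop :=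
  Continuous f ∧ ∀ e ∈ atlas E G, SmoothOnOpen (fun v => e (f v)) (f ⁻¹' e.source)

variable (E G) in
/-- `G` is a regular Lie group in Milnor's sense: each smooth curve `γ` in its Lie algebra has an
evolution `η_γ`, and the map `C^∞([0,1], T_1 G) → G`, `γ ↦ η_γ(1)` is (well defined and) smooth. -/
structure IsRegularLieGroup : Prop extends IsLCLieGroup E G where
  exists_evolution : ∀ γ : SmoothCurve E, ∃ η : I → G, IsEvolution γ.toCurve η
  smooth_evol : ∃ evol : SmoothCurve E → G,
    (∀ (γ : SmoothCurve E) (η : I → G), IsEvolution γ.toCurve η → evol γ = η 1) ∧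
    IsSmoothMapInto (E := E) evol

end LieGroup

/-! ### Continuous inverse algebras and their unit groups -/

section CIA

variable (A : Type*) [Ring A] [TopologicalSpace A]

/-- The condition on a locally convex, unital, associative topological algebra to be a continuous
inverse algebra: the set of units is open and inversion is continuous on it. -/
class IsContinuousInverseAlgebra : Prop where
  isOpen_units : IsOpen {x : A | IsUnit x}
  continuousOn_inverse : ContinuousOn Ring.inverse {x : A | IsUnit x}

theorem isOpenEmbedding_unitsVal_of_cia [IsContinuousInverseAlgebra A] :
    IsOpenEmbedding (Units.val : Aˣ → A) := by
  refine ⟨Units.isEmbedding_val_mk' (f := Ring.inverse)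
    IsContinuousInverseAlgebra.continuousOn_inverse (fun u => Ring.inverse_unit u), ?_⟩
  exact IsContinuousInverseAlgebra.isOpen_units (A := A)

/-- The unit group `A^×` is an open subset of `A`, and as such it is a manifold modelled on `A`,
with the inclusion as its only chart. -/
noncomputable instance unitsChartedSpaceOfCIA [IsContinuousInverseAlgebra A] :
    ChartedSpace A Aˣ :=
  (isOpenEmbedding_unitsVal_of_cia A).singletonChartedSpace

end CIA

section ConditionStar

variable {𝕜 A : Type*} [RCLike 𝕜] [Ring A] [Algebra 𝕜 A]

/-- `‖μ_n‖_{p,q} ∈ [0,∞]`, where `μ_n (x₁, …, x_n) = x₁ x₂ ⋯ x_n`: the supremum of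
`p (x₁ x₂ ⋯ x_n)` over all `x₁, …, x_n` with `q (x_i) ≤ 1`. -/
noncomputable def mulSeminorm (n : ℕ) (p q : Seminorm 𝕜 A) : ℝ≥0∞ :=
  ⨆ (x : Fin n → A) (_ : ∀ i, q (x i) ≤ 1), ENNReal.ofReal (p (List.ofFn x).prod)

variable (𝕜 A) in
/-- Condition `(*)`: for each continuous seminorm `p` there are a continuous seminorm `q` and
`r > 0` with `∑_{n ≥ 1} r^n ‖μ_n‖_{p,q} < ∞`. -/
def ConditionStar [TopologicalSpace A] : Prop :=
  ∀ p : Seminorm 𝕜 A, Continuous p → ∃ q : Seminorm 𝕜 A, Continuous q ∧ ∃ r : ℝ, 0 < r ∧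
    ∑' n : ℕ, ENNReal.ofReal r ^ (n + 1) * mulSeminorm (n + 1) p q < ⊤

end ConditionStar

/-! Condition `(*)` enters once, to make the topology of `A` locally m-convex. Since the terms of
the series are bounded, all nonempty products of elements of a sufficiently small `q`-ball `U` lie
in the unit ball of `p`. The convex hull of the multiplicative semigroup generated by `U` is then a
multiplicatively closed neighbourhood of `0`, and its gauge is a continuous submultiplicative
seminorm dominating `p` (`ConditionStar.isLocallyMConvex`).

With submultiplicative seminorms the linear equation `η' = η γ + δ η` is accessible to Picard
iteration. Mackey-completeness replaces completeness in two ways. Lipschitz curves have primitives,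
so each iterate exists. Series with terms `O(8⁻ⁿ)` converge, because they can be written as the
integral of a Lipschitz curve made of bumps on dyadic intervals; so the iterates can be summed.
Solutions are stable by Grönwall's inequality. The choice `δ = 0` gives the evolution `η`, and the
equation `ζ' = -γ ζ` gives its inverse, so `η` takes values in the units
(`IsMackeyComplete.exists_linearODE_solution`, `IsLeftEvolution.isUnit`).

For smoothness of `γ ↦ η_γ(1)`, pass to the tangent algebra `A ⊕ Aε` with `ε² = 0`, realised as
`TrivSqZeroExt A A`. It is again Mackey-complete and locally m-convex. The evolution of `γ + ε δ` in
it is `η + ε ξ`, where `ξ` is the derivative of the evolution of `γ` in the direction `δ`. Hence the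
total derivative of an evolution map is a component of another evolution map, and induction on the
order of differentiability gives `C^n` for all `n` (`contDirDiffOn_evolution`).

The manifold structure on the units has a single chart, the inclusion into `A`, so the statements
about the Lie group reduce to statements about maps and curves in `A`. -/

/-! ### Directional calculus by recursion on the total derivative -/

section CalculusRec

universe u v

/-- `f` is `n` times continuously directionally differentiable on `U`, defined by recursion: the
total directional derivative `(x, y) ↦ (D_y f)(x)` is required to be `n - 1` times continuously
directionally differentiable on `U ×ˢ univ`. -/
def ContDirDiffOn (F : Type v) [AddCommGroup F] [Module ℝ F] [TopologicalSpace F] :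
    (n : ℕ) → {E : Type u} → [AddCommGroup E] → [Module ℝ E] → [TopologicalSpace E] →
      (E → F) → Set E → Prop
  | 0, _, _, _, _, f, U => ContinuousOn f U
  | n + 1, E, _, _, _, f, U => ContinuousOn f U ∧ ∃ df : E × E → F,
      (∀ x ∈ U, ∀ y, HasDirDerivAt f (df (x, y)) x y) ∧
        ContDirDiffOn F n (E := E × E) df (U ×ˢ univ)

variable {E E' : Type u} {F F' : Type v} [AddCommGroup E] [Module ℝ E] [TopologicalSpace E]
  [AddCommGroup E'] [Module ℝ E'] [TopologicalSpace E']
  [AddCommGroup F] [Module ℝ F] [TopologicalSpace F]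
  [AddCommGroup F'] [Module ℝ F'] [TopologicalSpace F']

theorem tendsto_add_smul_punctured [ContinuousAdd E] [ContinuousSMul ℝ E] (x y : E) :
    Tendsto (fun h : ℝ => x + h • y) (𝓝[≠] 0) (𝓝 x) := by
  have : ContinuousAt (fun h : ℝ => x + h • y) 0 := by fun_prop
  have h := this.tendsto
  simp only [zero_smul, add_zero] at h
  exact h.mono_left nhdsWithin_le_nhds

theorem HasDirDerivAt.congr_of_eventuallyEq [ContinuousAdd E] [ContinuousSMul ℝ E]
    {f g : E → F} {v : F} {x y : E} (h : HasDirDerivAt f v x y) (hfg : f =ᶠ[𝓝 x] g) :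
    HasDirDerivAt g v x y := by
  refine h.congr' ?_
  filter_upwards [(tendsto_add_smul_punctured x y).eventually hfg] with t ht
  rw [ht, hfg.eq_of_nhds]

theorem HasDirDerivAt.unique [T2Space F] {f : E → F} {v w : F} {x y : E}
    (hv : HasDirDerivAt f v x y) (hw : HasDirDerivAt f w x y) : v = w :=
  tendsto_nhds_unique hv hw

theorem HasDirDerivAt.tendsto_apply [ContinuousAdd F] [ContinuousSMul ℝ F] {f : E → F} {v : F}
    {x y : E} (h : HasDirDerivAt f v x y) :
    Tendsto (fun t : ℝ => f (x + t • y)) (𝓝[≠] 0) (𝓝 (f x)) := by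
  have h0 : Tendsto (fun t : ℝ => t) (𝓝[≠] 0) (𝓝 0) := nhdsWithin_le_nhds
  have := (h0.smul h).add_const (f x)
  simp only [zero_smul, zero_add] at this
  refine this.congr' ?_
  filter_upwards [self_mem_nhdsWithin] with t ht
  rw [smul_inv_smul₀ ht, sub_add_cancel]

theorem HasDirDerivAt.add [ContinuousAdd F] {f g : E → F} {v w : F} {x y : E}
    (hf : HasDirDerivAt f v x y) (hg : HasDirDerivAt g w x y) :
    HasDirDerivAt (fun z => f z + g z) (v + w) x y := by
  refine (Tendsto.add hf hg).congr fun t => ?_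
  rw [← smul_add, add_sub_add_comm]

theorem HasDirDerivAt.clm_comp {f : E → F} {v : F} {x y : E} (hf : HasDirDerivAt f v x y)
    (L : F →L[ℝ] F') : HasDirDerivAt (fun z => L (f z)) (L v) x y := by
  refine ((L.continuous.tendsto v).comp hf).congr fun t => ?_
  simp

theorem HasDirDerivAt.comp_clm {f : E → F} {v : F} (L : E' →L[ℝ] E) {x y : E'}
    (hf : HasDirDerivAt f v (L x) (L y)) : HasDirDerivAt (fun z => f (L z)) v x y := by
  refine Tendsto.congr (fun t => ?_) hf
  simp

theorem HasDirDerivAt.mul {R : Type v} [Ring R] [Algebra ℝ R] [TopologicalSpace R]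
    [IsTopologicalRing R] [ContinuousSMul ℝ R] {f g : E → R} {v w : R} {x y : E}
    (hf : HasDirDerivAt f v x y) (hg : HasDirDerivAt g w x y) :
    HasDirDerivAt (fun z => f z * g z) (v * g x + f x * w) x y := by
  refine ((Tendsto.mul hf hg.tendsto_apply).add (Tendsto.const_mul (f x) hg)).congr fun t => ?_
  rw [smul_mul_assoc, mul_smul_comm, ← smul_add]
  congr 1
  noncomm_ring

theorem ContDirDiffOn.continuousOn {n : ℕ} {f : E → F} {U : Set E}
    (h : ContDirDiffOn F n f U) : ContinuousOn f U := by
  cases n with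
  | zero => exact h
  | succ n => exact h.1

theorem ContDirDiffOn.of_succ {n : ℕ} {E : Type u} [AddCommGroup E] [Module ℝ E]
    [TopologicalSpace E] {f : E → F} {U : Set E} (h : ContDirDiffOn F (n + 1) f U) :
    ContDirDiffOn F n f U := by
  induction n generalizing E with
  | zero => exact h.1
  | succ n ih =>
    obtain ⟨hc, df, hd, hdf⟩ := h
    exact ⟨hc, df, hd, ih hdf⟩

theorem ContDirDiffOn.congr {n : ℕ} {E : Type u} [AddCommGroup E] [Module ℝ E]
    [TopologicalSpace E] [ContinuousAdd E] [ContinuousSMul ℝ E]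
    {f g : E → F} {U : Set E} (h : ContDirDiffOn F n f U) (hU : IsOpen U) (hfg : EqOn g f U) :
    ContDirDiffOn F n g U := by
  cases n with
  | zero => exact ContinuousOn.congr h hfg
  | succ n =>
    obtain ⟨hc, df, hd, hdf⟩ := h
    refine ⟨hc.congr hfg, df, fun x hx y => ?_, hdf⟩
    exact (hd x hx y).congr_of_eventuallyEq (hfg.symm.eventuallyEq_of_mem (hU.mem_nhds hx))

theorem ContDirDiffOn.mono {n : ℕ} {E : Type u} [AddCommGroup E] [Module ℝ E]
    [TopologicalSpace E] {f : E → F} {U V : Set E} (h : ContDirDiffOn F n f U) (hV : V ⊆ U) :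
    ContDirDiffOn F n f V := by
  induction n generalizing E with
  | zero => exact ContinuousOn.mono h hV
  | succ n ih =>
    obtain ⟨hc, df, hd, hdf⟩ := h
    exact ⟨hc.mono hV, df, fun x hx => hd x (hV hx), ih hdf (prod_mono hV le_rfl)⟩

theorem ContDirDiffOn.clm_comp {n : ℕ} {E : Type u} [AddCommGroup E] [Module ℝ E]
    [TopologicalSpace E] {f : E → F} {U : Set E} (h : ContDirDiffOn F n f U) (L : F →L[ℝ] F') :
    ContDirDiffOn F' n (fun x => L (f x)) U := by
  induction n generalizing E with
  | zero => exact L.continuous.comp_continuousOn h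
  | succ n ih =>
    obtain ⟨hc, df, hd, hdf⟩ := h
    exact ⟨L.continuous.comp_continuousOn hc, _, fun x hx y => (hd x hx y).clm_comp L, ih hdf⟩

theorem ContDirDiffOn.comp_clm {n : ℕ} {E E' : Type u} [AddCommGroup E] [Module ℝ E]
    [TopologicalSpace E] [AddCommGroup E'] [Module ℝ E'] [TopologicalSpace E']
    {f : E → F} {U : Set E} (h : ContDirDiffOn F n f U) (L : E' →L[ℝ] E) :
    ContDirDiffOn F n (fun x => f (L x)) (L ⁻¹' U) := by
  induction n generalizing E E' with
  | zero => exact ContinuousOn.comp h L.continuous.continuousOn fun _ hx => hx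
  | succ n ih =>
    obtain ⟨hc, df, hd, hdf⟩ := h
    refine ⟨hc.comp L.continuous.continuousOn fun _ hx => hx, fun z => df (L z.1, L z.2),
      fun x hx y => (hd _ hx _).comp_clm L, ?_⟩
    exact (ih hdf (L.prodMap L)).mono fun z hz => ⟨hz.1, trivial⟩

theorem ContDirDiffOn.comp_fst {n : ℕ} {f : E → F} {U : Set E} (h : ContDirDiffOn F n f U) :
    ContDirDiffOn F n (fun z : E × E' => f z.1) (U ×ˢ univ) :=
  (h.comp_clm (ContinuousLinearMap.fst ℝ E E')).mono fun _ hz => hz.1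

theorem ContDirDiffOn.add [ContinuousAdd F] {n : ℕ} {E : Type u} [AddCommGroup E] [Module ℝ E]
    [TopologicalSpace E] {f g : E → F} {U : Set E} (hf : ContDirDiffOn F n f U)
    (hg : ContDirDiffOn F n g U) : ContDirDiffOn F n (fun x => f x + g x) U := by
  induction n generalizing E with
  | zero => exact ContinuousOn.add hf hg
  | succ n ih =>
    obtain ⟨hfc, df, hfd, hdf⟩ := hf
    obtain ⟨hgc, dg, hgd, hdg⟩ := hg
    exact ⟨hfc.add hgc, _, fun x hx y => (hfd x hx y).add (hgd x hx y), ih hdf hdg⟩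

theorem ContDirDiffOn.mul {R : Type v} [Ring R] [Algebra ℝ R] [TopologicalSpace R]
    [IsTopologicalRing R] [ContinuousSMul ℝ R] {n : ℕ} {E : Type u} [AddCommGroup E] [Module ℝ E]
    [TopologicalSpace E] {f g : E → R} {U : Set E} (hf : ContDirDiffOn R n f U)
    (hg : ContDirDiffOn R n g U) : ContDirDiffOn R n (fun x => f x * g x) U := by
  induction n generalizing E with
  | zero => exact ContinuousOn.mul hf hg
  | succ n ih =>
    have hf' := hf.of_succ.comp_fst (E' := E)
    have hg' := hg.of_succ.comp_fst (E' := E)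
    obtain ⟨hfc, df, hfd, hdf⟩ := hf
    obtain ⟨hgc, dg, hgd, hdg⟩ := hg
    exact ⟨hfc.mul hgc, fun z => df z * g z.1 + f z.1 * dg z,
      fun x hx y => (hfd x hx y).mul (hgd x hx y), (ih hdf hg').add (ih hf' hdg)⟩

theorem ContinuousLinearMap.contDirDiffOn (L : E →L[ℝ] F) (n : ℕ) (U : Set E) :
    ContDirDiffOn F n L U := by
  induction n generalizing E with
  | zero => exact L.continuous.continuousOn
  | succ n ih =>
    refine ⟨L.continuous.continuousOn, L.comp (ContinuousLinearMap.snd ℝ E E), fun x _ y => ?_,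
      ih _ _⟩
    refine tendsto_const_nhds.congr' ?_
    filter_upwards [self_mem_nhdsWithin] with t ht
    simp [inv_smul_smul₀ (show t ≠ 0 from ht)]

open Classical in
/-- The total directional derivative `(x, y) ↦ (D_y f)(x)`, zero where it does not exist. -/
noncomputable def totalDirDeriv (f : E → F) (z : E × E) : F :=
  if h : ∃ v, HasDirDerivAt f v z.1 z.2 then h.choose else 0

theorem HasDirDerivAt.totalDirDeriv_eq [T2Space F] {f : E → F} {v : F} {x y : E}
    (h : HasDirDerivAt f v x y) : totalDirDeriv f (x, y) = v := by
  have h' : ∃ v, HasDirDerivAt f v (x, y).1 (x, y).2 := ⟨v, h⟩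
  rw [totalDirDeriv, dif_pos h']
  exact h'.choose_spec.unique h

theorem ContDirDiffOn.hasDirDerivAt_totalDirDeriv [T2Space F] {n : ℕ} {f : E → F} {U : Set E}
    (h : ContDirDiffOn F (n + 1) f U) {x : E} (hx : x ∈ U) (y : E) :
    HasDirDerivAt f (totalDirDeriv f (x, y)) x y := by
  obtain ⟨-, df, hd, -⟩ := h
  rw [(hd x hx y).totalDirDeriv_eq]
  exact hd x hx y

theorem ContDirDiffOn.totalDirDeriv [IsTopologicalAddGroup E] [ContinuousSMul ℝ E] [T2Space F]
    {n : ℕ} {f : E → F} {U : Set E} (h : ContDirDiffOn F (n + 1) f U) (hU : IsOpen U) :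
    ContDirDiffOn F n (totalDirDeriv f) (U ×ˢ univ) := by
  obtain ⟨-, df, hd, hdf⟩ := h
  exact hdf.congr (hU.prod isOpen_univ) fun z hz => (hd z.1 hz.1 z.2).totalDirDeriv_eq

/-- The iterated directional derivatives `(D_{y_k} ⋯ D_{y_1} f)(x)`, computed from the total
directional derivative. -/
noncomputable def iterDirDeriv (F : Type v) [AddCommGroup F] [Module ℝ F] [TopologicalSpace F] :
    (k : ℕ) → {E : Type u} → [AddCommGroup E] → [Module ℝ E] → [TopologicalSpace E] →
      (E → F) → E → (Fin k → E) → F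
  | 0, _, _, _, _, f, x, _ => f x
  | k + 1, E, _, _, _, f, x, y =>
    iterDirDeriv F k (E := E × E) (totalDirDeriv f) (x, y 0) fun i => (y i.succ, 0)

/-- The recursion splits off the first direction, whereas the claim is about the last one. The two
fit together because the line `(x, y 0) + t (y, 0)` moves only the base point, so the induction
hypothesis for `totalDirDeriv f` is a statement about differentiation in `x`. -/
theorem hasDirDerivAt_iterDirDeriv [T2Space F] {E : Type u} [AddCommGroup E] [Module ℝ E]
    [TopologicalSpace E] [IsTopologicalAddGroup E] [ContinuousSMul ℝ E] {k : ℕ} {f : E → F}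
    {U : Set E} (hU : IsOpen U) (h : ∀ n, ContDirDiffOn F n f U) {x : E} (hx : x ∈ U)
    (y : Fin (k + 1) → E) :
    HasDirDerivAt (fun z => iterDirDeriv F k f z (Fin.init y)) (iterDirDeriv F (k + 1) f x y) x
      (y (Fin.last k)) := by
  induction k generalizing E with
  | zero => exact (h 1).hasDirDerivAt_totalDirDeriv hx _
  | succ k ih =>
    have := ih (hU.prod isOpen_univ) (fun n => (h (n + 1)).totalDirDeriv hU)
      (x := (x, y 0)) ⟨hx, trivial⟩ fun i => (y i.succ, 0)
    refine Tendsto.congr (fun t => ?_) this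
    simp only [Prod.smul_mk, Prod.mk_add_mk, smul_zero, add_zero, Fin.succ_last]
    rfl

theorem continuousOn_iterDirDeriv [T2Space F] {E : Type u} [AddCommGroup E] [Module ℝ E]
    [TopologicalSpace E] [IsTopologicalAddGroup E] [ContinuousSMul ℝ E] {k : ℕ} {f : E → F}
    {U : Set E} (hU : IsOpen U) (h : ∀ n, ContDirDiffOn F n f U) :
    ContinuousOn (fun z : E × (Fin k → E) => iterDirDeriv F k f z.1 z.2) (U ×ˢ univ) := by
  induction k generalizing E with
  | zero => exact (h 0).continuousOn.comp continuousOn_fst fun z hz => hz.1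
  | succ k ih =>
    have := ih (hU.prod isOpen_univ) (fun n => (h (n + 1)).totalDirDeriv hU)
    have hc : Continuous fun z : E × (Fin (k + 1) → E) =>
      (((z.1, z.2 0), fun i => (z.2 i.succ, 0)) : (E × E) × (Fin k → E × E)) := by fun_prop
    exact this.comp hc.continuousOn fun z hz => ⟨⟨hz.1, trivial⟩, trivial⟩

theorem smoothOnOpen_of_contDirDiffOn [T2Space F] [IsTopologicalAddGroup E] [ContinuousSMul ℝ E]
    {f : E → F} {U : Set E} (hU : IsOpen U) (h : ∀ n, ContDirDiffOn F n f U) :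
    SmoothOnOpen f U :=
  ⟨fun k => iterDirDeriv F k f, fun _ _ _ => rfl,
    fun _ _ hx y => hasDirDerivAt_iterDirDeriv hU h hx y,
    fun _ => continuousOn_iterDirDeriv hU h⟩

theorem SmoothOnOpen.congr {f g : E → F} {U : Set E} (h : SmoothOnOpen f U) (hfg : EqOn g f U) :
    SmoothOnOpen g U := by
  obtain ⟨d, h0, hd, hc⟩ := h
  exact ⟨d, fun x hx y => (h0 x hx y).trans (hfg hx).symm, hd, hc⟩

/-- Inversion in a continuous inverse algebra is `C^n` on the set of units. -/
theorem contDirDiffOn_ringInverse {R : Type v} [Ring R] [Algebra ℝ R] [TopologicalSpace R]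
    [IsTopologicalRing R] [ContinuousSMul ℝ R] [IsContinuousInverseAlgebra R] (n : ℕ) :
    ContDirDiffOn R n (Ring.inverse : R → R) {x | IsUnit x} := by
  have hc := IsContinuousInverseAlgebra.continuousOn_inverse (A := R)
  have hU := IsContinuousInverseAlgebra.isOpen_units (A := R)
  induction n with
  | zero => exact hc
  | succ n ih =>
    -- The derivative comes from the identity `(x + t y)⁻¹ - x⁻¹ = -t (x + t y)⁻¹ y x⁻¹`. It is
    -- built from inversion itself by products and linear maps, so the induction hypothesis makes it
    -- `C^n`.
    refine ⟨hc, fun z => -(Ring.inverse z.1 * z.2 * Ring.inverse z.1), fun x hx y => ?_, ?_⟩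
    · have hx' := tendsto_add_smul_punctured x y
      have h1 : Tendsto (fun t : ℝ => Ring.inverse (x + t • y)) (𝓝[≠] 0) (𝓝 (Ring.inverse x)) :=
        (hc.continuousAt (hU.mem_nhds hx)).tendsto.comp hx'
      refine ((h1.mul_const y).mul_const (Ring.inverse x)).neg.congr' ?_
      filter_upwards [hx'.eventually (hU.mem_nhds hx), self_mem_nhdsWithin] with t ht ht0
      have e : Ring.inverse (x + t • y) - Ring.inverse x =
          t • -(Ring.inverse (x + t • y) * y * Ring.inverse x) := by
        have hx1 := Ring.mul_inverse_cancel x hx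
        have hx2 := Ring.inverse_mul_cancel _ ht
        calc _ = Ring.inverse (x + t • y) * (x * Ring.inverse x) -
              Ring.inverse (x + t • y) * (x + t • y) * Ring.inverse x := by
                rw [hx1, hx2, mul_one, one_mul]
          _ = _ := by
                simp only [mul_add, add_mul, mul_smul_comm, smul_mul_assoc, smul_neg, mul_assoc]
                abel
      rw [e, inv_smul_smul₀ ht0]
    · have h1 := ih.comp_fst (E' := R)
      have h2 := (ContinuousLinearMap.snd ℝ R R).contDirDiffOn n ({x : R | IsUnit x} ×ˢ univ)
      exact ((h1.mul h2).mul h1).clm_comp (-ContinuousLinearMap.id ℝ R)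

end CalculusRec

/-! ### Differentiable curves, mean value and Grönwall inequalities -/

section Curves

variable {E F : Type*} [AddCommGroup E] [Module ℝ E] [TopologicalSpace E]
  [AddCommGroup F] [Module ℝ F] [TopologicalSpace F]

theorem HasCurveDerivAt.clm_comp {w : I → E} {v : E} {t : I} (h : HasCurveDerivAt w v t)
    (L : E →L[ℝ] F) : HasCurveDerivAt (fun s => L (w s)) (L v) t := by
  refine ((L.continuous.tendsto v).comp h).congr fun s => ?_
  simp

theorem hasCurveDerivAt_const (v : E) (t : I) : HasCurveDerivAt (fun _ => v) 0 t := by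
  simpa [HasCurveDerivAt] using tendsto_const_nhds

theorem tendsto_unitInterval_coe_sub (t : I) :
    Tendsto (fun s : I => (s : ℝ) - t) (𝓝[≠] t) (𝓝[≠] 0) := by
  refine tendsto_nhdsWithin_iff.2 ⟨?_, ?_⟩
  · have : Continuous fun s : I => (s : ℝ) - t := by fun_prop
    simpa using (this.tendsto t).mono_left nhdsWithin_le_nhds
  · filter_upwards [self_mem_nhdsWithin] with s hs
    exact sub_ne_zero.2 fun h => hs (Subtype.ext h)

variable [IsTopologicalAddGroup E] [ContinuousSMul ℝ E]

theorem HasCurveDerivAt.add {w₁ w₂ : I → E} {v₁ v₂ : E} {t : I} (h₁ : HasCurveDerivAt w₁ v₁ t)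
    (h₂ : HasCurveDerivAt w₂ v₂ t) : HasCurveDerivAt (fun s => w₁ s + w₂ s) (v₁ + v₂) t := by
  refine (Tendsto.add h₁ h₂).congr fun s => ?_
  rw [← smul_add, add_sub_add_comm]

theorem HasCurveDerivAt.neg {w : I → E} {v : E} {t : I} (h : HasCurveDerivAt w v t) :
    HasCurveDerivAt (fun s => -w s) (-v) t :=
  h.clm_comp (-ContinuousLinearMap.id ℝ E)

theorem HasCurveDerivAt.sub {w₁ w₂ : I → E} {v₁ v₂ : E} {t : I} (h₁ : HasCurveDerivAt w₁ v₁ t)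
    (h₂ : HasCurveDerivAt w₂ v₂ t) : HasCurveDerivAt (fun s => w₁ s - w₂ s) (v₁ - v₂) t := by
  simpa only [sub_eq_add_neg] using h₁.add h₂.neg

theorem HasCurveDerivAt.const_smul {w : I → E} {v : E} {t : I} (c : ℝ)
    (h : HasCurveDerivAt w v t) : HasCurveDerivAt (fun s => c • w s) (c • v) t :=
  h.clm_comp (c • ContinuousLinearMap.id ℝ E)

theorem hasCurveDerivAt_sum {ι : Type*} (u : Finset ι) {w : ι → I → E} {v : ι → E} {t : I}
    (h : ∀ i ∈ u, HasCurveDerivAt (w i) (v i) t) :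
    HasCurveDerivAt (fun s => ∑ i ∈ u, w i s) (∑ i ∈ u, v i) t := by
  refine (tendsto_finsetSum u h).congr fun s => ?_
  rw [← Finset.smul_sum, Finset.sum_sub_distrib]

theorem HasDerivAt.hasCurveDerivAt_smul_const {φ : ℝ → ℝ} {φ' : ℝ} {t : I}
    (h : HasDerivAt φ φ' t) (v : E) : HasCurveDerivAt (fun s : I => φ s • v) (φ' • v) t := by
  have h1 := (h.tendsto_slope_zero.comp (tendsto_unitInterval_coe_sub t)).smul_const v
  refine h1.congr fun s => ?_
  simp [sub_smul, smul_sub, mul_smul]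

theorem HasCurveDerivAt.tendsto {w : I → E} {v : E} {t : I} (h : HasCurveDerivAt w v t) :
    Tendsto w (𝓝[≠] t) (𝓝 (w t)) := by
  have h0 : Tendsto (fun s : I => (s : ℝ) - t) (𝓝[≠] t) (𝓝 0) :=
    (tendsto_unitInterval_coe_sub t).mono_right nhdsWithin_le_nhds
  have h1 := (h0.smul h).add_const (w t)
  rw [zero_smul, zero_add] at h1
  refine h1.congr' ?_
  filter_upwards [self_mem_nhdsWithin] with s hs
  rw [smul_inv_smul₀ (sub_ne_zero.2 fun h => hs (Subtype.ext h)), sub_add_cancel]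

theorem continuous_of_hasCurveDerivAt {w w' : I → E} (h : ∀ t, HasCurveDerivAt w (w' t) t) :
    Continuous w :=
  continuous_iff_continuousAt.2 fun t => continuousAt_iff_punctured_nhds.2 (h t).tendsto

theorem HasCurveDerivAt.mul {R : Type*} [Ring R] [Algebra ℝ R] [TopologicalSpace R]
    [IsTopologicalRing R] [ContinuousSMul ℝ R] {w₁ w₂ : I → R} {v₁ v₂ : R} {t : I}
    (h₁ : HasCurveDerivAt w₁ v₁ t) (h₂ : HasCurveDerivAt w₂ v₂ t) :
    HasCurveDerivAt (fun s => w₁ s * w₂ s) (v₁ * w₂ t + w₁ t * v₂) t := by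
  refine ((Tendsto.mul h₁ h₂.tendsto).add (Tendsto.const_mul (w₁ t) h₂)).congr fun s => ?_
  rw [smul_mul_assoc, mul_smul_comm, ← smul_add]
  congr 1
  noncomm_ring

/-- The function `p ∘ w` need not be differentiable, but by the triangle inequality its right
difference quotients are at most `p` of those of `w`. This is the hypothesis of the one-sided
comparison theorems for real functions; `projIcc` extends the curve to `ℝ` for their use. -/
theorem HasCurveDerivAt.eventually_seminorm_slope_lt {w : I → E} {v : E} {t : I}
    (h : HasCurveDerivAt w v t) {p : Seminorm ℝ E} (hp : Continuous p) (ht : t < 1) {r : ℝ}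
    (hr : p v < r) :
    ∀ᶠ z in 𝓝[>] (t : ℝ), slope (fun x => p (w (projIcc 0 1 zero_le_one x))) t z < r := by
  have h1 : ∀ᶠ s : I in 𝓝[≠] t, p (((s : ℝ) - t)⁻¹ • (w s - w t)) < r :=
    ((hp.tendsto v).comp h).eventually_lt_const hr
  have h2 : Tendsto (projIcc (0 : ℝ) 1 zero_le_one) (𝓝[>] (t : ℝ)) (𝓝[≠] t) := by
    refine tendsto_nhdsWithin_iff.2 ⟨?_, ?_⟩
    · have := (continuous_projIcc (a := (0 : ℝ)) (b := 1) (h := zero_le_one)).tendsto t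
      rw [projIcc_val] at this
      exact this.mono_left nhdsWithin_le_nhds
    · filter_upwards [Ioo_mem_nhdsGT (show (t : ℝ) < 1 from ht)] with z hz hzt
      rw [projIcc_of_mem zero_le_one ⟨t.2.1.trans hz.1.le, hz.2.le⟩] at hzt
      exact hz.1.ne' (congrArg Subtype.val hzt)
  filter_upwards [h2.eventually h1, Ioo_mem_nhdsGT (show (t : ℝ) < 1 from ht)] with z hz hz'
  have hzI : z ∈ Icc (0 : ℝ) 1 := ⟨t.2.1.trans hz'.1.le, hz'.2.le⟩
  rw [projIcc_of_mem zero_le_one hzI, map_smul_eq_mul, Real.norm_eq_abs, abs_inv,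
    abs_of_pos (sub_pos.2 hz'.1)] at hz
  refine lt_of_le_of_lt ?_ hz
  have hsub := map_add_le_add p (w ⟨z, hzI⟩ - w t) (w t)
  rw [sub_add_cancel] at hsub
  rw [slope_def_field, projIcc_val, projIcc_of_mem zero_le_one hzI, div_eq_inv_mul]
  exact mul_le_mul_of_nonneg_left (sub_le_iff_le_add.2 hsub) (inv_nonneg.2 (sub_nonneg.2 hz'.1.le))

theorem continuous_seminorm_comp_projIcc {w w' : I → E} (h : ∀ t, HasCurveDerivAt w (w' t) t)
    {p : Seminorm ℝ E} (hp : Continuous p) :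
    Continuous fun x => p (w (projIcc 0 1 zero_le_one x)) :=
  hp.comp ((continuous_of_hasCurveDerivAt h).comp continuous_projIcc)

/-- If a seminorm of the derivative of a curve is bounded by the derivative of `B`, then
the seminorm of the curve is bounded by `B`. -/
theorem seminorm_curve_le_of_deriv_le {w w' : I → E} (h : ∀ t, HasCurveDerivAt w (w' t) t)
    {p : Seminorm ℝ E} (hp : Continuous p) {B B' : ℝ → ℝ} (hB : ∀ x, HasDerivAt B (B' x) x)
    {a b : I} (ha : p (w a) ≤ B a) (hb : ∀ t, a ≤ t → t < b → p (w' t) ≤ B' t) {t : I}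
    (hat : a ≤ t) (htb : t ≤ b) : p (w t) ≤ B t := by
  have := image_le_of_liminf_slope_right_le_deriv_boundary (a := (a : ℝ)) (b := b)
    (f := fun x => p (w (projIcc 0 1 zero_le_one x)))
    (continuous_seminorm_comp_projIcc h hp).continuousOn (B := B) (B' := B')
    (by simpa using ha) (fun x _ => (hB x).continuousAt.continuousWithinAt)
    (fun x _ => (hB x).hasDerivWithinAt) (fun x hx r hr => ?_) (x := t) ⟨hat, htb⟩
  · simpa using this
  · lift x to I using ⟨a.2.1.trans hx.1, hx.2.le.trans b.2.2⟩
    exact ((h x).eventually_seminorm_slope_lt hp (lt_of_lt_of_le hx.2 b.2.2)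
      ((hb x hx.1 hx.2).trans_lt hr)).frequently

/-- The mean value inequality. -/
theorem seminorm_curve_sub_le {w w' : I → E} (h : ∀ t, HasCurveDerivAt w (w' t) t)
    {p : Seminorm ℝ E} (hp : Continuous p) {M : ℝ} {a b : I} (hab : a ≤ b)
    (hb : ∀ t, a ≤ t → t < b → p (w' t) ≤ M) : p (w b - w a) ≤ M * (b - a) := by
  refine seminorm_curve_le_of_deriv_le (w := fun t => w t - w a) (w' := w')
    (fun t => by simpa using (h t).sub (hasCurveDerivAt_const (w a) t)) hp
    (B := fun x => M * (x - a)) (B' := fun _ => M) (fun x => ?_) (by simp) hb hab le_rfl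
  simpa using ((hasDerivAt_id x).sub_const (a : ℝ)).const_mul M

/-- A Grönwall inequality for a seminorm of a curve. -/
theorem seminorm_curve_le_of_deriv_le_mul_add {w w' : I → E}
    (h : ∀ t, HasCurveDerivAt w (w' t) t) {p : Seminorm ℝ E} (hp : Continuous p) {K ε : ℝ}
    (hK : 0 ≤ K) (hε : 0 ≤ ε) (h0 : w 0 = 0) (hb : ∀ t, p (w' t) ≤ K * p (w t) + ε) (t : I) :
    p (w t) ≤ ε * Real.exp (K + 1) := by
  -- The rate `K + 1` in place of `K` avoids the degenerate Grönwall bound at `K = 0`.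
  have hK1 : 0 < K + 1 := by linarith
  have := le_gronwallBound_of_liminf_deriv_right_le (a := 0) (b := 1) (δ := 0) (K := K + 1)
    (ε := ε) (f := fun x => p (w (projIcc 0 1 zero_le_one x)))
    (f' := fun x => p (w' (projIcc 0 1 zero_le_one x)))
    (continuous_seminorm_comp_projIcc h hp).continuousOn (fun x hx r hr => ?_)
    (by rw [projIcc_left]; exact (congrArg p h0).le.trans (map_zero p).le) (fun x _ => ?_) t t.2
  · rw [projIcc_val] at this
    refine this.trans ?_
    rw [gronwallBound_of_K_ne_0 hK1.ne']
    have h2 : Real.exp ((K + 1) * (t - 0)) ≤ Real.exp (K + 1) := by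
      refine Real.exp_le_exp.2 ?_
      have := t.2.2
      nlinarith
    have h3 : ε / (K + 1) ≤ ε := div_le_self hε (by linarith)
    have h4 : 0 ≤ ε / (K + 1) := by positivity
    have h5 := Real.exp_pos (K + 1)
    calc 0 * Real.exp ((K + 1) * (t - 0)) + ε / (K + 1) * (Real.exp ((K + 1) * (t - 0)) - 1)
        ≤ ε / (K + 1) * Real.exp (K + 1) := by
          rw [zero_mul, zero_add]
          exact mul_le_mul_of_nonneg_left (by linarith) h4
      _ ≤ ε * Real.exp (K + 1) := mul_le_mul_of_nonneg_right h3 h5.le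
  · lift x to I using ⟨hx.1, hx.2.le⟩
    rw [projIcc_val] at hr
    refine (((h x).eventually_seminorm_slope_lt hp hx.2 hr).mono fun z hz => ?_).frequently
    rwa [slope_def_field, div_eq_inv_mul] at hz
  · refine (hb _).trans ?_
    have := apply_nonneg p (w (projIcc 0 1 zero_le_one x))
    linarith

theorem exists_seminorm_curve_le {w : I → E} (h : Continuous w) {p : Seminorm ℝ E}
    (hp : Continuous p) : ∃ K, 0 ≤ K ∧ ∀ t, p (w t) ≤ K := by
  obtain ⟨K, hK⟩ := (isCompact_range (hp.comp h)).bddAbove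
  exact ⟨K, (apply_nonneg p _).trans (hK ⟨0, rfl⟩), fun t => hK ⟨t, rfl⟩⟩

variable [LocallyConvexSpace ℝ E]

theorem tendsto_nhds_iff_seminorm {ι : Type*} {u : ι → E} {l : Filter ι} {y : E} :
    Tendsto u l (𝓝 y) ↔
      ∀ p : Seminorm ℝ E, Continuous p → ∀ ε, 0 < ε → ∀ᶠ x in l, p (u x - y) < ε := by
  rw [(PolynormableSpace.withSeminorms ℝ E).tendsto_nhds]
  exact ⟨fun h p hp => h ⟨p, hp⟩, fun h p => h p.1 p.2⟩

theorem eq_of_forall_seminorm_sub_le_zero [T2Space E] {x y : E}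
    (h : ∀ p : Seminorm ℝ E, Continuous p → p (x - y) ≤ 0) : x = y := by
  refine tendsto_nhds_unique (f := fun _ : ℕ => x) (l := atTop) tendsto_const_nhds ?_
  rw [tendsto_nhds_iff_seminorm]
  exact fun p hp ε hε => Eventually.of_forall fun _ => (h p hp).trans_lt hε

/-- Hahn–Banach extension of `c • v ↦ c * p v` from the line through `v`. It turns a seminorm
estimate into a scalar one. -/
theorem exists_strongDual_apply_eq_seminorm {p : Seminorm ℝ E} (hp : Continuous p) (v : E) :
    ∃ f : StrongDual ℝ E, f v = p v ∧ ∀ x, |f x| ≤ p x := by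
  by_cases hv : v = 0
  · exact ⟨0, by simp [hv], fun x => by simp⟩
  let e := LinearEquiv.toSpanNonzeroSingleton ℝ E v hv
  have hle : ∀ x, (p v • e.symm.toLinearMap) x ≤ p x := by
    intro x
    obtain ⟨c, rfl⟩ := e.surjective x
    have hc : (e c : E) = c • v := rfl
    simp only [LinearMap.smul_apply, LinearEquiv.coe_coe, LinearEquiv.symm_apply_apply, hc,
      smul_eq_mul, map_smul_eq_mul, Real.norm_eq_abs]
    rw [mul_comm]
    exact mul_le_mul_of_nonneg_right (le_abs_self c) (apply_nonneg p v)
  obtain ⟨g, hg, hgp⟩ := Module.Dual.exists_continuous_extension_of_le_seminorm_real _ _ hp hle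
  refine ⟨g, ?_, hgp⟩
  have h1 : e.symm ⟨v, Submodule.mem_span_singleton_self v⟩ = 1 :=
    LinearEquiv.coord_self ℝ E v hv
  simpa [h1] using hg ⟨v, Submodule.mem_span_singleton_self v⟩

theorem isLipschitzCurve_iff {γ : I → E} : IsLipschitzCurve γ ↔
    ∀ p : Seminorm ℝ E, Continuous p → ∃ M, ∀ s t : I, p (γ t - γ s) ≤ M * |(t : ℝ) - s| := by
  rw [IsLipschitzCurve,
    (PolynormableSpace.withSeminorms ℝ E).isVonNBounded_iff_seminorm_bounded]
  have key : ∀ (p : Seminorm ℝ E) (s t : I), s ≠ t →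
      p (((t : ℝ) - s)⁻¹ • (γ t - γ s)) * |(t : ℝ) - s| = p (γ t - γ s) := by
    intro p s t hst
    have : |(t : ℝ) - s| ≠ 0 := abs_ne_zero.2 (sub_ne_zero.2 fun h => hst (Subtype.ext h.symm))
    rw [map_smul_eq_mul, Real.norm_eq_abs, abs_inv, mul_right_comm, inv_mul_cancel₀ this, one_mul]
  constructor
  · intro h p hp
    obtain ⟨M, -, hM⟩ := h ⟨p, hp⟩
    refine ⟨M, fun s t => ?_⟩
    rcases eq_or_ne s t with rfl | hst
    · simp
    rw [← key p s t hst]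
    exact mul_le_mul_of_nonneg_right (hM _ ⟨s, t, hst, rfl⟩).le (abs_nonneg _)
  · rintro h ⟨p, hp⟩
    obtain ⟨M, hM⟩ := h p hp
    refine ⟨|M| + 1, by positivity, ?_⟩
    rintro _ ⟨s, t, hst, rfl⟩
    have h0 : 0 < |(t : ℝ) - s| := abs_pos.2 (sub_ne_zero.2 fun h => hst (Subtype.ext h.symm))
    refine lt_of_le_of_lt (le_of_mul_le_mul_right ?_ h0) (lt_add_of_le_of_pos (le_abs_self M) one_pos)
    rw [key p s t hst]
    exact hM s t

theorem IsLipschitzCurve.continuous {γ : I → E} (h : IsLipschitzCurve γ) : Continuous γ := by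
  rw [isLipschitzCurve_iff] at h
  refine continuous_iff_continuousAt.2 fun t => tendsto_nhds_iff_seminorm.2 fun p hp ε hε => ?_
  obtain ⟨M, hM⟩ := h p hp
  have hc : Continuous fun s : I => M * |(s : ℝ) - t| := by fun_prop
  have := (hc.tendsto t).eventually_lt_const (show M * |(t : ℝ) - t| < ε by simpa using hε)
  exact this.mono fun s hs => (hM t s).trans_lt hs

theorem isLipschitzCurve_of_hasCurveDerivAt {w w' : I → E}
    (h : ∀ t, HasCurveDerivAt w (w' t) t)
    (hb : ∀ p : Seminorm ℝ E, Continuous p → ∃ K, ∀ t, p (w' t) ≤ K) : IsLipschitzCurve w := by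
  refine isLipschitzCurve_iff.2 fun p hp => ?_
  obtain ⟨K, hK⟩ := hb p hp
  refine ⟨K, fun s t => ?_⟩
  rcases le_total s t with hst | hst
  · rw [abs_of_nonneg (sub_nonneg.2 (Subtype.coe_le_coe.2 hst))]
    exact seminorm_curve_sub_le h hp hst fun t _ _ => hK t
  · rw [abs_sub_comm, abs_of_nonneg (sub_nonneg.2 (Subtype.coe_le_coe.2 hst)), map_sub_rev]
    exact seminorm_curve_sub_le h hp hst fun t _ _ => hK t

theorem eq_of_hasCurveDerivAt_zero [T2Space E] {w w' : I → E} (h : ∀ t, HasCurveDerivAt w (w' t) t)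
    {a b : I} (hab : a ≤ b) (h0 : ∀ t, a ≤ t → t < b → w' t = 0) : w b = w a :=
  eq_of_forall_seminorm_sub_le_zero fun p hp => by
    simpa using seminorm_curve_sub_le h hp hab (M := 0) fun t hat htb => by simp [h0 t hat htb]

end Curves

/-! ### Integration and convergence of series in Mackey-complete spaces -/

section Primitives

/-- The mean value theorem for integrals supplies a tag in each interval of a uniform partition for
which the Riemann sum equals the integral exactly. Every neighbourhood of `J` therefore contains the
integral. -/
theorem HasRiemannIntegral.eq_intervalIntegral {g : I → ℝ} {J : ℝ} (h : HasRiemannIntegral g J)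
    (hg : Continuous g) : J = ∫ x in (0 : ℝ)..1, g (projIcc 0 1 zero_le_one x) := by
  set G : ℝ → ℝ := fun x => g (projIcc 0 1 zero_le_one x) with hG
  have hGc : Continuous G := hg.comp continuous_projIcc
  refine (eq_of_forall_dist_le fun ε hε => ?_).symm
  obtain ⟨δ, hδ, H⟩ := h (Metric.ball J ε) (Metric.ball_mem_nhds J hε)
  obtain ⟨n, hn⟩ := exists_nat_one_div_lt hδ
  set x : ℕ → I := fun i => projIcc 0 1 zero_le_one (i / (n + 1)) with hx
  have hn0 : (0 : ℝ) < n + 1 := by positivity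
  have hxv : ∀ i ≤ n + 1, (x i : ℝ) = i / (n + 1) := by
    intro i hi
    have : (i : ℝ) ≤ n + 1 := by exact_mod_cast hi
    exact congrArg Subtype.val
      (projIcc_of_mem zero_le_one ⟨by positivity, (div_le_one hn0).2 this⟩)
  have hstep : ∀ i < n + 1, (x (i + 1) : ℝ) - x i = 1 / (n + 1) := by
    intro i hi
    rw [hxv i hi.le, hxv (i + 1) hi]
    push_cast
    ring
  have hξ : ∀ i, ∃ ξ : I, i < n + 1 → (x i ≤ ξ ∧ ξ ≤ x (i + 1)) ∧
      ((x (i + 1) : ℝ) - x i) • g ξ = ∫ y in (x i : ℝ)..x (i + 1), G y := by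
    intro i
    by_cases hi : i < n + 1
    · have hlt : (x i : ℝ) < x (i + 1) := by
        rw [← sub_pos, hstep i hi]
        positivity
      obtain ⟨c, hc, hGcv⟩ := exists_eq_interval_average hlt.ne hGc.continuousOn
      rw [uIoo_of_lt hlt] at hc
      have hcI : c ∈ Icc (0 : ℝ) 1 := ⟨(x i).2.1.trans hc.1.le, hc.2.le.trans (x (i + 1)).2.2⟩
      refine ⟨⟨c, hcI⟩, fun _ => ⟨⟨hc.1.le, hc.2.le⟩, ?_⟩⟩
      have : g ⟨c, hcI⟩ = G c := by
        change _ = g (projIcc 0 1 zero_le_one c)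
        rw [projIcc_of_mem zero_le_one hcI]
      rw [this, hGcv, interval_average_eq, smul_inv_smul₀ (sub_pos.2 hlt).ne']
    · exact ⟨0, fun h => absurd h hi⟩
  choose ξ hξ using hξ
  have hmem := H (n + 1) x ξ (by simp [hx]) ?_ fun i hi =>
    ⟨(hξ i hi).1.1, (hξ i hi).1.2, by rw [hstep i hi]; exact hn⟩
  · rw [Finset.sum_congr rfl fun i hi => (hξ i (Finset.mem_range.1 hi)).2,
      intervalIntegral.sum_integral_adjacent_intervals
        fun i _ => hGc.intervalIntegrable _ _] at hmem
    have h0 : (x 0 : ℝ) = 0 := by simp [hxv 0 (Nat.zero_le _)]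
    have h1 : (x (n + 1) : ℝ) = 1 := by
      rw [hxv _ le_rfl]
      push_cast
      exact div_self hn0.ne'
    rw [h0, h1] at hmem
    exact (Metric.mem_ball.1 hmem).le
  · refine Subtype.ext ?_
    rw [hxv _ le_rfl]
    push_cast
    exact div_self hn0.ne'

variable {E : Type*} [AddCommGroup E] [Module ℝ E] [TopologicalSpace E]

theorem HasRiemannIntegral.clm_comp {γ : I → E} {J : E} (h : HasRiemannIntegral γ J)
    (f : StrongDual ℝ E) : HasRiemannIntegral (fun t => f (γ t)) (f J) := by
  intro U hU
  obtain ⟨δ, hδ, H⟩ := h _ (f.continuous.continuousAt.preimage_mem_nhds hU)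
  refine ⟨δ, hδ, fun n x ξ h0 h1 hi => ?_⟩
  simpa using H n x ξ h0 h1 hi

variable [IsTopologicalAddGroup E] [ContinuousSMul ℝ E] [LocallyConvexSpace ℝ E]

/-- A weak primitive of a continuous curve is a primitive: for given `s`, `t` and `p`, a functional
norming the error of the difference quotient reduces the estimate to a scalar integral of `f (c x) -
f (c t)`. The bound is uniform in the functional, since only `|f| ≤ p` is used. -/
theorem hasCurveDerivAt_of_forall_strongDual {c C : I → E} (hc : Continuous c)
    (h : ∀ (f : StrongDual ℝ E) (t : I),
      f (C t) = ∫ x in (0 : ℝ)..t, f (c (projIcc 0 1 zero_le_one x))) (t : I) :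
    HasCurveDerivAt C (c t) t := by
  refine tendsto_nhds_iff_seminorm.2 fun p hp ε hε => ?_
  have hε2 : 0 < ε / 2 := half_pos hε
  have hnear : ∀ᶠ s in 𝓝 t, p (c s - c t) < ε / 2 :=
    tendsto_nhds_iff_seminorm.1 (hc.tendsto t) p hp _ hε2
  obtain ⟨δ, hδ, hball⟩ := Metric.eventually_nhds_iff.1 hnear
  have hmem : ∀ᶠ s in 𝓝[≠] t, dist s t < δ :=
    nhdsWithin_le_nhds (Metric.ball_mem_nhds t hδ)
  filter_upwards [hmem, self_mem_nhdsWithin] with s hs hst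
  have hne : (s : ℝ) - t ≠ 0 := sub_ne_zero.2 fun h => hst (Subtype.ext h)
  obtain ⟨f, hfv, hfp⟩ := exists_strongDual_apply_eq_seminorm hp
    (((s : ℝ) - t)⁻¹ • (C s - C t) - c t)
  have hgc : Continuous fun x : ℝ => f (c (projIcc 0 1 zero_le_one x)) :=
    f.continuous.comp (hc.comp continuous_projIcc)
  have hsub : f (C s) - f (C t) - ((s : ℝ) - t) * f (c t) =
      ∫ x in (t : ℝ)..s, (f (c (projIcc 0 1 zero_le_one x)) - f (c t)) := by
    rw [intervalIntegral.integral_sub (hgc.intervalIntegrable _ _) intervalIntegrable_const, h, h,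
      intervalIntegral.integral_interval_sub_left (hgc.intervalIntegrable _ _)
        (hgc.intervalIntegrable _ _), intervalIntegral.integral_const, smul_eq_mul]
  have hle : ‖f (C s) - f (C t) - ((s : ℝ) - t) * f (c t)‖ ≤ ε / 2 * |(s : ℝ) - t| := by
    rw [hsub]
    refine intervalIntegral.norm_integral_le_of_norm_le_const fun x hx => ?_
    have hx' := uIoc_subset_uIcc hx
    have hxI : x ∈ Icc (0 : ℝ) 1 := uIcc_subset_Icc t.2 s.2 hx'
    rw [projIcc_of_mem zero_le_one hxI, ← map_sub]
    refine ((hfp _).trans (hball ?_).le)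
    refine lt_of_le_of_lt ?_ hs
    change |x - t| ≤ |(s : ℝ) - t|
    exact abs_sub_left_of_mem_uIcc hx'
  rw [← hfv]
  have heq : f (((s : ℝ) - t)⁻¹ • (C s - C t) - c t) =
      ((s : ℝ) - t)⁻¹ * (f (C s) - f (C t) - ((s : ℝ) - t) * f (c t)) := by
    rw [mul_sub, inv_mul_cancel_left₀ hne]
    simp
  have h0 : 0 < |(s : ℝ) - t| := abs_pos.2 hne
  calc f (((s : ℝ) - t)⁻¹ • (C s - C t) - c t)
      ≤ ‖((s : ℝ) - t)⁻¹ * (f (C s) - f (C t) - ((s : ℝ) - t) * f (c t))‖ := by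
        rw [heq]
        exact le_abs_self _
    _ ≤ |(s : ℝ) - t|⁻¹ * (ε / 2 * |(s : ℝ) - t|) := by
        rw [norm_mul, norm_inv, Real.norm_eq_abs ((s : ℝ) - t)]
        exact mul_le_mul_of_nonneg_left hle (by positivity)
    _ = ε / 2 := by field_simp
    _ < ε := half_lt_self hε

/-- In a Mackey-complete space, Lipschitz curves have primitives. -/
theorem IsMackeyComplete.exists_primitive (hE : IsMackeyComplete E) {c : I → E}
    (hc : IsLipschitzCurve c) : ∃ C : I → E, C 0 = 0 ∧ ∀ t, HasCurveDerivAt C (c t) t := by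
  have hcc := hc.continuous
  -- The integral from `0` to `t` is rescaled to the unit interval as `∫₀¹ t c(t u) du`, and the
  -- rescaled curve is still Lipschitz.
  have hint : ∀ t : I, ∃ J, HasRiemannIntegral (fun u : I => (t : ℝ) • c (t * u)) J := by
    intro t
    refine hE _ (isLipschitzCurve_iff.2 fun p hp => ?_)
    obtain ⟨M, hM⟩ := isLipschitzCurve_iff.1 hc p hp
    refine ⟨|M|, fun s u => ?_⟩
    have ht0 := t.2.1
    have ht1 := t.2.2
    rw [← smul_sub, map_smul_eq_mul, Real.norm_eq_abs, abs_of_nonneg ht0]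
    have h1 : p (c (t * u) - c (t * s)) ≤ |M| * |(u : ℝ) - s| := by
      refine (hM _ _).trans ?_
      have e : ((t * u : I) : ℝ) - (t * s : I) = t * (u - s) := by
        push_cast
        ring
      rw [e, abs_mul, abs_of_nonneg ht0]
      refine mul_le_mul (le_abs_self M) ?_ (by positivity) (abs_nonneg M)
      exact mul_le_of_le_one_left (abs_nonneg _) ht1
    exact (mul_le_of_le_one_left (apply_nonneg p _) ht1).trans h1
  choose J hJ using hint
  have hd := hasCurveDerivAt_of_forall_strongDual (C := J) hcc fun f t => by
    have h1 := ((hJ t).clm_comp f).eq_intervalIntegral (by fun_prop)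
    rw [h1]
    have h2 : ∀ x ∈ uIcc (0 : ℝ) 1, f ((t : ℝ) • c (t * projIcc 0 1 zero_le_one x)) =
        (t : ℝ) * (fun y => f (c (projIcc 0 1 zero_le_one y))) (t * x) := by
      intro x hx
      rw [uIcc_of_le zero_le_one] at hx
      have : t * projIcc 0 1 zero_le_one x = projIcc 0 1 zero_le_one ((t : ℝ) * x) := by
        rw [projIcc_of_mem zero_le_one hx, projIcc_of_mem zero_le_one
          ⟨mul_nonneg t.2.1 hx.1, mul_le_one₀ t.2.2 hx.1 hx.2⟩]
        rfl
      rw [map_smul, this, smul_eq_mul]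
    have h3 := intervalIntegral.mul_integral_comp_mul_left (a := 0) (b := 1) (t : ℝ)
      (f := fun y => f (c (projIcc 0 1 zero_le_one y)))
    rw [mul_zero, mul_one] at h3
    rw [intervalIntegral.integral_congr h2, intervalIntegral.integral_const_mul, ← h3]
  exact ⟨fun t => J t - J 0, sub_self _,
    fun t => by simpa using (hd t).sub (hasCurveDerivAt_const (J 0) t)⟩

/-- A curve on `[0,1]` that passes through `0` at `0` and at the points `2⁻ⁿ`, and runs along the
direction `b n` on the interval `[2⁻ⁿ⁻¹, 2⁻ⁿ]`. -/
theorem exists_lipschitzCurve_of_bounded {b : ℕ → E}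
    (hb : ∀ p : Seminorm ℝ E, Continuous p → ∃ M, ∀ n, p (b n) ≤ M) :
    ∃ c : I → E, IsLipschitzCurve c ∧ ∀ (n : ℕ) (t : I), (1 / 2 : ℝ) ^ (n + 1) < t →
      (t : ℝ) ≤ (1 / 2) ^ n → c t = ((t - (1 / 2) ^ (n + 1)) * ((1 / 2) ^ n - t) : ℝ) • b n := by
  have hanti : StrictAnti fun n : ℕ => (1 / 2 : ℝ) ^ n :=
    pow_right_strictAnti₀ (by norm_num) (by norm_num)
  have hexists : ∀ t : I, ∃ n : ℕ, 0 < (t : ℝ) → (1 / 2 : ℝ) ^ (n + 1) < t ∧ (t : ℝ) ≤ (1 / 2) ^ n := by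
    intro t
    by_cases ht : 0 < (t : ℝ)
    · obtain ⟨n, hn⟩ := exists_nat_pow_near_of_lt_one ht t.2.2 (show (0 : ℝ) < 1 / 2 by norm_num)
        (by norm_num)
      exact ⟨n, fun _ => hn⟩
    · exact ⟨0, fun h => absurd h ht⟩
  choose N hN using hexists
  have hle : ∀ {s t : I}, 0 < (s : ℝ) → s < t → N t ≤ N s := by
    intro s t hs hst
    have h1 := (hN s hs).2
    have h2 := (hN t (hs.trans hst)).2
    have h3 := (hN s hs).1
    by_contra hlt
    push Not at hlt
    have := hanti.antitone (Nat.succ_le_of_lt hlt)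
    have hst' : (s : ℝ) < t := hst
    have h4 : (t : ℝ) ≤ (1 / 2) ^ (N s + 1) := h2.trans this
    exact lt_irrefl _ ((hst'.trans_le h4).trans h3)
  refine ⟨fun t => if 0 < (t : ℝ) then
    ((t - (1 / 2) ^ (N t + 1)) * ((1 / 2) ^ N t - t) : ℝ) • b (N t) else 0, ?_, ?_⟩
  · refine isLipschitzCurve_iff.2 fun p hp => ?_
    obtain ⟨M, hM⟩ := hb p hp
    have hM0 : 0 ≤ M := (apply_nonneg p _).trans (hM 0)
    have hpow : ∀ n : ℕ, (0 : ℝ) < (1 / 2) ^ n ∧ ((1 / 2 : ℝ)) ^ n ≤ 1 := fun n =>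
      ⟨by positivity, pow_le_one₀ (by norm_num) (by norm_num)⟩
    have hsmul : ∀ (r B : ℝ) (n : ℕ), |r| ≤ B → p (r • b n) ≤ B * M := by
      intro r B n hr
      rw [map_smul_eq_mul, Real.norm_eq_abs]
      exact mul_le_mul hr (hM n) (apply_nonneg p _) ((abs_nonneg r).trans hr)
    have main : ∀ s t : I, s < t → p ((if 0 < (t : ℝ) then
        ((t - (1 / 2) ^ (N t + 1)) * ((1 / 2) ^ N t - t) : ℝ) • b (N t) else 0) -
        (if 0 < (s : ℝ) then
        ((s - (1 / 2) ^ (N s + 1)) * ((1 / 2) ^ N s - s) : ℝ) • b (N s) else 0)) ≤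
        2 * M * ((t : ℝ) - s) := by
      intro s t hst
      have hst' : (s : ℝ) < t := hst
      have ht0 : 0 < (t : ℝ) := s.2.1.trans_lt hst
      obtain ⟨ht1, ht2⟩ := hN t ht0
      obtain ⟨hp1, hp2⟩ := hpow (N t)
      obtain ⟨hp3, hp4⟩ := hpow (N t + 1)
      have ht3 := t.2.2
      rw [if_pos ht0]
      have hdiff : 0 ≤ M * ((t : ℝ) - s) := mul_nonneg hM0 (by linarith)
      by_cases hs0 : 0 < (s : ℝ)
      · rw [if_pos hs0]
        obtain ⟨hs1, hs2⟩ := hN s hs0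
        rcases (hle hs0 hst).eq_or_lt with heq | hlt
        · rw [← heq] at hs1 hs2 ⊢
          rw [← sub_smul]
          refine (hsmul _ (2 * (t - s)) _ ?_).trans (by linarith)
          have e : ((t : ℝ) - (1 / 2) ^ (N t + 1)) * ((1 / 2) ^ N t - t) -
              (s - (1 / 2) ^ (N t + 1)) * ((1 / 2) ^ N t - s) =
              ((1 / 2) ^ N t + (1 / 2) ^ (N t + 1) - t - s) * (t - s) := by ring
          rw [e, abs_mul, abs_of_pos (sub_pos.2 hst')]
          refine mul_le_mul_of_nonneg_right ?_ (sub_pos.2 hst').le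
          rw [abs_le]
          constructor <;> linarith
        -- Here a dyadic point separates `s` and `t`. Each bump coefficient is at most the distance
        -- to either end of its interval, hence at most `t - s`, and the two are estimated
        -- separately.
        · have hgap : (1 / 2 : ℝ) ^ N s ≤ (1 / 2) ^ (N t + 1) :=
            hanti.antitone (Nat.succ_le_of_lt hlt)
          obtain ⟨hp5, hp6⟩ := hpow (N s)
          obtain ⟨hp7, hp8⟩ := hpow (N s + 1)
          refine (map_sub_le_add p _ _).trans ?_
          have h1 := hsmul (((t : ℝ) - (1 / 2) ^ (N t + 1)) * ((1 / 2) ^ N t - t)) (t - s) (N t) (by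
            rw [abs_of_nonneg (mul_nonneg (by linarith) (by linarith))]
            nlinarith)
          have h2 := hsmul (((s : ℝ) - (1 / 2) ^ (N s + 1)) * ((1 / 2) ^ N s - s)) (t - s) (N s) (by
            rw [abs_of_nonneg (mul_nonneg (by linarith) (by linarith))]
            nlinarith)
          linarith
      · have hs : (s : ℝ) = 0 := le_antisymm (not_lt.1 hs0) s.2.1
        rw [if_neg hs0, sub_zero, hs, sub_zero]
        have h1 := hsmul (((t : ℝ) - (1 / 2) ^ (N t + 1)) * ((1 / 2) ^ N t - t)) t (N t) (by
          rw [abs_of_nonneg (mul_nonneg (by linarith) (by linarith))]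
          nlinarith)
        rw [hs, sub_zero] at hdiff
        linarith
    refine ⟨2 * M, fun s t => ?_⟩
    rcases lt_trichotomy s t with hst | rfl | hst
    · rw [abs_of_pos (sub_pos.2 (Subtype.coe_lt_coe.2 hst))]
      exact main s t hst
    · simp
    · rw [abs_sub_comm, abs_of_pos (sub_pos.2 (Subtype.coe_lt_coe.2 hst)), map_sub_rev]
      exact main t s hst
  · intro n t h1 h2
    have ht : 0 < (t : ℝ) := lt_trans (by positivity) h1
    have hn : N t = n := by
      obtain ⟨h3, h4⟩ := hN t ht
      have h5 : n < N t + 1 := hanti.lt_iff_gt.1 (h3.trans_le h2)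
      have h6 : N t < n + 1 := hanti.lt_iff_gt.1 (h1.trans_le h4)
      omega
    simp only [if_pos ht, hn]

/-- In a Mackey-complete space, series with terms `b n / 8 ^ n`, where `b` is bounded, converge. -/
theorem IsMackeyComplete.exists_tendsto_sum [T2Space E] (hE : IsMackeyComplete E) {x : ℕ → E}
    (hx : ∀ p : Seminorm ℝ E, Continuous p → ∃ M, ∀ n, 8 ^ n * p (x n) ≤ M) :
    ∃ S, Tendsto (fun n => ∑ i ∈ Finset.range n, x i) atTop (𝓝 S) := by
  -- The bump on `[2⁻ⁿ⁻¹, 2⁻ⁿ]` has integral `(2⁻ⁿ⁻¹)³ / 6 = 1 / (48 * 8 ^ n)`. With this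
  -- normalisation the integral of `c` over that interval is `x n`, so the series telescopes along a
  -- primitive of `c`.
  obtain ⟨c, hc, hcn⟩ := exists_lipschitzCurve_of_bounded (b := fun n => (48 * 8 ^ n : ℝ) • x n)
    fun p hp => by
      obtain ⟨M, hM⟩ := hx p hp
      refine ⟨48 * M, fun n => ?_⟩
      rw [map_smul_eq_mul, Real.norm_eq_abs, abs_of_pos (by positivity), mul_assoc]
      exact mul_le_mul_of_nonneg_left (hM n) (by norm_num)
  obtain ⟨C, hC0, hC⟩ := hE.exists_primitive hc
  have hpow : ∀ n : ℕ, (1 / 2 : ℝ) ^ n ∈ Icc (0 : ℝ) 1 := fun n =>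
    ⟨by positivity, pow_le_one₀ (by norm_num) (by norm_num)⟩
  set a : ℕ → I := fun n => ⟨(1 / 2) ^ n, hpow n⟩ with ha
  have hstep : ∀ n, C (a n) - C (a (n + 1)) = x n := by
    intro n
    set α : ℝ := (1 / 2) ^ (n + 1) with hα
    set β : ℝ := (1 / 2) ^ n with hβ
    have hαβ : β = 2 * α := by
      rw [hα, hβ, pow_succ]
      ring
    set Φ : ℝ → ℝ := fun t => -(t ^ 3 / 3) + (α + β) * (t ^ 2 / 2) - α * β * t with hΦ
    have hΦd : ∀ t, HasDerivAt Φ ((t - α) * (β - t)) t := by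
      intro t
      have h1 := ((hasDerivAt_pow 3 t).div_const 3).neg
      have h2 := ((hasDerivAt_pow 2 t).div_const 2).const_mul (α + β)
      have h3 := (hasDerivAt_id t).const_mul (α * β)
      refine ((h1.add h2).sub h3).congr_deriv ?_
      norm_num
      ring
    have hab : a (n + 1) ≤ a n := show (1 / 2 : ℝ) ^ (n + 1) ≤ (1 / 2) ^ n from
      pow_le_pow_of_le_one (by norm_num) (by norm_num) (Nat.le_succ n)
    have hz := eq_of_hasCurveDerivAt_zero
      (fun t => (hC t).sub ((hΦd t).hasCurveDerivAt_smul_const ((48 * 8 ^ n : ℝ) • x n))) hab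
      fun t h1 h2 => by
        -- The formula for `c` with index `n` excludes the left end point, which belongs to the next
        -- dyadic interval; there both bumps vanish.
        rcases h1.eq_or_lt with rfl | h1
        · rcases hab.eq_or_lt with h | h
          · exact absurd h2 (by rw [h]; exact lt_irrefl _)
          · have h4 : a (n + 1) ≤ (1 / 2 : ℝ) ^ (n + 1) := le_rfl
            have h5 : (1 / 2 : ℝ) ^ (n + 1 + 1) < a (n + 1) :=
              pow_lt_pow_right_of_lt_one₀ (by norm_num) (by norm_num) (Nat.lt_succ_self _)
            rw [hcn (n + 1) _ h5 h4]
            simp [ha, hα]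
        · rw [hcn n t h1 h2.le, sub_self]
    have e : Φ (a n) - Φ (a (n + 1)) = (48 * 8 ^ n)⁻¹ := by
      have hα3 : α ^ 3 = (8 * 8 ^ n)⁻¹ := by
        rw [hα, ← pow_mul, mul_comm, pow_mul, ← pow_succ', ← inv_pow]
        norm_num
      have h6 : Φ (a n) - Φ (a (n + 1)) = α ^ 3 / 6 := by
        change Φ β - Φ α = _
        rw [hΦ, hαβ]
        ring
      rw [h6, hα3, mul_inv, mul_inv]
      ring
    have h7 : C (a n) - C (a (n + 1)) = (Φ (a n) - Φ (a (n + 1))) • (48 * 8 ^ n : ℝ) • x n := by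
      rw [sub_smul]
      rw [sub_eq_sub_iff_sub_eq_sub] at hz
      exact hz
    rw [h7, e, inv_smul_smul₀ (by positivity)]
  have hsum : ∀ n, ∑ i ∈ Finset.range n, x i = C (a 0) - C (a n) := by
    intro n
    rw [← Finset.sum_range_sub' (fun i => C (a i))]
    exact Finset.sum_congr rfl fun i _ => (hstep i).symm
  refine ⟨C (a 0), ?_⟩
  simp_rw [hsum]
  have hlim : Tendsto a atTop (𝓝 0) := by
    rw [tendsto_subtype_rng]
    exact tendsto_pow_atTop_nhds_zero_of_lt_one (by norm_num) (by norm_num)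
  have := ((continuous_of_hasCurveDerivAt hC).tendsto 0).comp hlim
  rw [hC0] at this
  simpa using tendsto_const_nhds.sub this

end Primitives

/-! ### Linear differential equations in locally m-convex algebras -/

section LinearODE

variable {A : Type*} [Ring A] [Algebra ℝ A] [TopologicalSpace A]

variable (A) in
/-- The topology of `A` is defined by submultiplicative seminorms. -/
def IsLocallyMConvex : Prop :=
  ∀ p : Seminorm ℝ A, Continuous p → ∃ q : Seminorm ℝ A, Continuous q ∧
    (∀ x y, q (x * y) ≤ q x * q y) ∧ ∀ x, p x ≤ q x

/-- `η` solves the initial value problem `η' = η γ`, `η 0 = 1`. -/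
structure IsLeftEvolution (γ η : I → A) : Prop where
  init : η 0 = 1
  deriv : ∀ t, HasCurveDerivAt η (η t * γ t) t

variable [IsTopologicalRing A] [ContinuousSMul ℝ A] [LocallyConvexSpace ℝ A]

theorem IsLipschitzCurve.add {c d : I → A} (hc : IsLipschitzCurve c) (hd : IsLipschitzCurve d) :
    IsLipschitzCurve fun t => c t + d t := by
  rw [isLipschitzCurve_iff] at *
  intro p hp
  obtain ⟨M, hM⟩ := hc p hp
  obtain ⟨N, hN⟩ := hd p hp
  refine ⟨M + N, fun s t => ?_⟩
  rw [add_sub_add_comm, add_mul]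
  exact (map_add_le_add p _ _).trans (add_le_add (hM s t) (hN s t))

theorem isLipschitzCurve_const (v : A) : IsLipschitzCurve fun _ => v :=
  isLipschitzCurve_iff.2 fun _ _ => ⟨0, fun _ _ => by simp⟩

/-- This is what keeps the Picard iteration within Lipschitz curves, the only ones for which
Mackey-completeness provides primitives. The factors are bounded because `[0,1]` is compact. -/
theorem IsLipschitzCurve.mul (hA : IsLocallyMConvex A) {c d : I → A} (hc : IsLipschitzCurve c)
    (hd : IsLipschitzCurve d) : IsLipschitzCurve fun t => c t * d t := by
  refine isLipschitzCurve_iff.2 fun p hp => ?_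
  obtain ⟨q, hq, hmul, hpq⟩ := hA p hp
  obtain ⟨M, hM⟩ := isLipschitzCurve_iff.1 hc q hq
  obtain ⟨N, hN⟩ := isLipschitzCurve_iff.1 hd q hq
  obtain ⟨K, hK0, hK⟩ := exists_seminorm_curve_le hc.continuous hq
  obtain ⟨L, hL0, hL⟩ := exists_seminorm_curve_le hd.continuous hq
  refine ⟨M * L + K * N, fun s t => (hpq _).trans ?_⟩
  have e : c t * d t - c s * d s = (c t - c s) * d t + c s * (d t - d s) := by noncomm_ring
  rw [e]
  calc q ((c t - c s) * d t + c s * (d t - d s))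
      ≤ q (c t - c s) * q (d t) + q (c s) * q (d t - d s) :=
        (map_add_le_add q _ _).trans (add_le_add (hmul _ _) (hmul _ _))
    _ ≤ (M * |(t : ℝ) - s|) * L + K * (N * |(t : ℝ) - s|) :=
        add_le_add
          (mul_le_mul (hM s t) (hL t) (apply_nonneg q _) ((apply_nonneg q _).trans (hM s t)))
          (mul_le_mul (hK s) (hN s t) (apply_nonneg q _) hK0)
    _ = (M * L + K * N) * |(t : ℝ) - s| := by ring

theorem seminorm_mul_add_mul_le {q : Seminorm ℝ A} (hmul : ∀ x y, q (x * y) ≤ q x * q y)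
    {x g d : A} {K L : ℝ} (hg : q g ≤ K) (hd : q d ≤ L) :
    q (x * g + d * x) ≤ (K + L) * q x := by
  refine (map_add_le_add q _ _).trans ?_
  have h1 := (hmul x g).trans (mul_le_mul_of_nonneg_left hg (apply_nonneg q x))
  have h2 := (hmul d x).trans (mul_le_mul_of_nonneg_right hd (apply_nonneg q x))
  linarith

/-- The Picard iteration for the equation `η' = η γ + δ η`. -/
theorem IsMackeyComplete.exists_picard_iterates (hE : IsMackeyComplete A)
    (hA : IsLocallyMConvex A) {γ δ : I → A} (hγ : IsLipschitzCurve γ) (hδ : IsLipschitzCurve δ) :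
    ∃ x : ℕ → I → A, (∀ t, x 0 t = 1) ∧ (∀ n, x (n + 1) 0 = 0) ∧
      ∀ n t, HasCurveDerivAt (x (n + 1)) (x n t * γ t + δ t * x n t) t := by
  have step : ∀ w : {w : I → A // IsLipschitzCurve w}, ∃ v : {w : I → A // IsLipschitzCurve w},
      v.1 0 = 0 ∧ ∀ t, HasCurveDerivAt v.1 (w.1 t * γ t + δ t * w.1 t) t := by
    rintro ⟨w, hw⟩
    have hL := (hw.mul hA hγ).add (hδ.mul hA hw)
    obtain ⟨v, hv0, hv⟩ := hE.exists_primitive hL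
    refine ⟨⟨v, isLipschitzCurve_of_hasCurveDerivAt hv fun p hp => ?_⟩, hv0, hv⟩
    obtain ⟨K, -, hK⟩ := exists_seminorm_curve_le hL.continuous hp
    exact ⟨K, hK⟩
  choose F hF0 hF using step
  let x : ℕ → {w : I → A // IsLipschitzCurve w} := fun n =>
    Nat.rec ⟨fun _ => 1, isLipschitzCurve_const 1⟩ (fun _ w => F w) n
  exact ⟨fun n => (x n).1, fun _ => rfl, fun n => hF0 (x n), fun n => hF (x n)⟩

/-- The linear initial value problem `η' = η γ + δ η`, `η 0 = 1` is solvable. -/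
theorem IsMackeyComplete.exists_linearODE_solution [T2Space A] (hE : IsMackeyComplete A)
    (hA : IsLocallyMConvex A) {γ δ : I → A} (hγ : IsLipschitzCurve γ) (hδ : IsLipschitzCurve δ) :
    ∃ η : I → A, η 0 = 1 ∧ ∀ t, HasCurveDerivAt η (η t * γ t + δ t * η t) t := by
  obtain ⟨x, hx0, hxn, hx⟩ := hE.exists_picard_iterates hA hγ hδ
  have bound : ∀ q : Seminorm ℝ A, Continuous q → (∀ x y, q (x * y) ≤ q x * q y) →
      ∃ K D : ℝ, 0 ≤ K ∧ 0 ≤ D ∧ (∀ t y, q (y * γ t + δ t * y) ≤ K * q y) ∧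
        ∀ n t, q (x n t) ≤ D / 16 ^ n := by
    intro q hq hmul
    obtain ⟨K, hK0, hK⟩ := exists_seminorm_curve_le hγ.continuous hq
    obtain ⟨L, hL0, hL⟩ := exists_seminorm_curve_le hδ.continuous hq
    have hKL : ∀ t y, q (y * γ t + δ t * y) ≤ (K + L) * q y := fun t y =>
      seminorm_mul_add_mul_le hmul (hK t) (hL t)
    -- With the weight `exp (M t)`, each integration gains a factor `(K + L) / M ≤ 1 / 16`. This
    -- gives geometric decay faster than the `8⁻ⁿ` required for summability.
    set M := 16 * (K + L + 1) with hM
    have hM0 : 0 ≤ M := by positivity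
    have hq1 := apply_nonneg q 1
    have hexp : ∀ n (t : I), q (x n t) ≤ q 1 * Real.exp (M * t) / 16 ^ n := by
      intro n
      induction n with
      | zero =>
        intro t
        rw [hx0, pow_zero, div_one]
        exact le_mul_of_one_le_right hq1 (Real.one_le_exp (mul_nonneg hM0 t.2.1))
      | succ n ih =>
        intro t
        refine seminorm_curve_le_of_deriv_le (hx n) hq (a := 0) (b := 1)
          (B := fun t => q 1 * Real.exp (M * t) / 16 ^ (n + 1))
          (B' := fun t => M * (q 1 * Real.exp (M * t) / 16 ^ (n + 1))) (fun t => ?_) ?_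
          (fun t _ _ => ?_) t.2.1 t.2.2
        · have h1 := (((hasDerivAt_id t).const_mul M).exp.const_mul (q 1)).div_const (16 ^ (n + 1))
          refine h1.congr_deriv ?_
          simp only [id, mul_one]
          ring
        · rw [hxn, map_zero]
          positivity
        · refine (hKL t _).trans ((mul_le_mul_of_nonneg_left (ih t) (by positivity)).trans ?_)
          have h2 : M * (q 1 * Real.exp (M * t) / 16 ^ (n + 1)) =
              (K + L + 1) * (q 1 * Real.exp (M * t) / 16 ^ n) := by
            rw [pow_succ]
            field_simp
            rw [hM]
            ring
          rw [h2]
          exact mul_le_mul_of_nonneg_right (by linarith) (by positivity)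
    refine ⟨K + L, q 1 * Real.exp M, by positivity, by positivity, hKL, fun n t =>
      (hexp n t).trans ?_⟩
    gcongr
    exact mul_le_of_le_one_right hM0 t.2.2
  have hlim : ∀ t, ∃ S, Tendsto (fun n => ∑ i ∈ Finset.range n, x i t) atTop (𝓝 S) := fun t =>
    hE.exists_tendsto_sum fun p hp => by
      obtain ⟨q, hq, hmul, hpq⟩ := hA p hp
      obtain ⟨K, D, -, hD, -, hxq⟩ := bound q hq hmul
      refine ⟨D, fun n => ?_⟩
      calc 8 ^ n * p (x n t) ≤ 16 ^ n * (D / 16 ^ n) :=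
            mul_le_mul (by gcongr; norm_num) ((hpq _).trans (hxq n t)) (apply_nonneg p _)
              (by positivity)
        _ = D := by field_simp
  choose η hη using hlim
  set S : ℕ → I → A := fun n t => ∑ i ∈ Finset.range n, x i t with hS
  -- The index shifts because the term `x 0 = 1` is constant and each further term is a primitive of
  -- the right-hand side at the preceding one.
  have hSd : ∀ n t, HasCurveDerivAt (S (n + 1)) (S n t * γ t + δ t * S n t) t := by
    intro n t
    have e : S (n + 1) = fun t => (∑ i ∈ Finset.range n, x (i + 1) t) + 1 := by
      funext t
      rw [hS]
      simp only [Finset.sum_range_succ', hx0]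
    have h1 := (hasCurveDerivAt_sum (Finset.range n) fun i _ => hx i t).add
      (hasCurveDerivAt_const (1 : A) t)
    rw [e]
    simpa [hS, Finset.sum_mul, Finset.mul_sum, Finset.sum_add_distrib] using h1
  have hS0 : ∀ n, S (n + 1) 0 = 1 := by
    intro n
    simp [hS, Finset.sum_range_succ', hx0, hxn]
  have htail : ∀ (q : Seminorm ℝ A) (D : ℝ), Continuous q → (∀ n t, q (x n t) ≤ D / 16 ^ n) →
      0 ≤ D → ∀ n t, q (η t - S n t) ≤ 2 * D / 16 ^ n := by
    intro q D hq hxq hD n t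
    have h1 : ∀ m, n ≤ m → q (S m t - S n t) ≤ 2 * D / 16 ^ n - 2 * D / 16 ^ m := by
      intro m hm
      induction m, hm using Nat.le_induction with
      | base => simp
      | succ m hm ih =>
        have e : S (m + 1) t - S n t = (S m t - S n t) + x m t := by
          rw [hS]
          simp only [Finset.sum_range_succ]
          abel
        rw [e]
        refine (map_add_le_add q _ _).trans ((add_le_add ih (hxq m t)).trans ?_)
        have h2 : 2 * D / 16 ^ (m + 1) ≤ D / 16 ^ m := by
          rw [pow_succ, div_le_div_iff₀ (by positivity) (by positivity)]
          have : 0 ≤ D * 16 ^ m := by positivity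
          linarith
        have h3 : 2 * D / 16 ^ m = D / 16 ^ m + D / 16 ^ m := by ring
        linarith
    have h2 : Tendsto (fun m => q (S m t - S n t)) atTop (𝓝 (q (η t - S n t))) :=
      (hq.tendsto _).comp ((hη t).sub_const _)
    refine le_of_tendsto h2 (eventually_atTop.2 ⟨n, fun m hm => (h1 m hm).trans ?_⟩)
    have : 0 ≤ 2 * D / 16 ^ m := by positivity
    linarith
  -- The right-hand side at `η` has a primitive only once `η` is known to be Lipschitz. The
  -- Lipschitz constants of the partial sums are uniform and pass to the limit.
  have hηL : IsLipschitzCurve η := by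
    refine isLipschitzCurve_iff.2 fun p hp => ?_
    obtain ⟨q, hq, hmul, hpq⟩ := hA p hp
    obtain ⟨K, D, hK, hD, hKq, hxq⟩ := bound q hq hmul
    obtain ⟨B, hB⟩ : ∃ B, ∀ n t, q (S n t) ≤ B := by
      refine ⟨2 * D + 2 * D, fun n t => ?_⟩
      have h0 : q (η t) ≤ 2 * D := by simpa [hS] using htail q D hq hxq hD 0 t
      have h1 := htail q D hq hxq hD n t
      have h2 : 2 * D / 16 ^ n ≤ 2 * D :=
        div_le_self (by positivity) (one_le_pow₀ (by norm_num))
      have h3 := map_sub_le_add q (η t) (η t - S n t)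
      rw [sub_sub_cancel] at h3
      linarith
    have main : ∀ s t : I, s ≤ t → q (η t - η s) ≤ K * B * ((t : ℝ) - s) := by
      intro s t hst
      have h2 : Tendsto (fun m => q (S (m + 1) t - S (m + 1) s)) atTop (𝓝 (q (η t - η s))) :=
        (hq.tendsto _).comp (((hη t).sub (hη s)).comp (tendsto_add_atTop_nat 1))
      refine le_of_tendsto' h2 fun m => ?_
      exact seminorm_curve_sub_le (hSd m) hq hst fun u _ _ =>
        (hKq u _).trans (mul_le_mul_of_nonneg_left (hB m u) hK)
    refine ⟨K * B, fun s t => (hpq _).trans ?_⟩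
    rcases le_total s t with hst | hst
    · rw [abs_of_nonneg (sub_nonneg.2 (Subtype.coe_le_coe.2 hst))]
      exact main s t hst
    · rw [abs_sub_comm, abs_of_nonneg (sub_nonneg.2 (Subtype.coe_le_coe.2 hst)), map_sub_rev]
      exact main t s hst
  obtain ⟨C, hC0, hC⟩ := hE.exists_primitive ((hηL.mul hA hγ).add (hδ.mul hA hηL))
  -- Both `C + 1` and `S (n + 1)` start at `1`, and their derivatives differ by the right-hand side
  -- at `η - S n`, which tends to `0` uniformly. So `S (n + 1)` converges to `C + 1` as well as to
  -- `η`.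
  have hCη : (fun t => C t + 1) = η := by
    funext t
    refine tendsto_nhds_unique (f := fun n => S (n + 1) t) (l := atTop) ?_
      ((hη t).comp (tendsto_add_atTop_nat 1))
    refine tendsto_nhds_iff_seminorm.2 fun p hp ε hε => ?_
    obtain ⟨q, hq, hmul, hpq⟩ := hA p hp
    obtain ⟨K, D, hK, hD, hKq, hxq⟩ := bound q hq hmul
    have h1 : ∀ n, q (S (n + 1) t - (C t + 1)) ≤ K * (2 * D / 16 ^ n) := by
      intro n
      have h2 := seminorm_curve_sub_le (a := 0) (b := t) (M := K * (2 * D / 16 ^ n))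
        (fun s => ((hSd n s).sub (hC s)).sub (hasCurveDerivAt_const (1 : A) s)) hq
        t.2.1 fun s _ _ => by
          have e : S n s * γ s + δ s * S n s - (η s * γ s + δ s * η s) - 0 =
              -((η s - S n s) * γ s + δ s * (η s - S n s)) := by noncomm_ring
          rw [e, map_neg_eq_map]
          exact (hKq s _).trans (mul_le_mul_of_nonneg_left (htail q D hq hxq hD n s) hK)
      rw [hS0, hC0, sub_zero, sub_self, sub_zero, sub_sub] at h2
      refine h2.trans (mul_le_of_le_one_right (by positivity) ?_)
      simpa using t.2.2
    have h3 : Tendsto (fun n : ℕ => K * (2 * D / 16 ^ n)) atTop (𝓝 0) := by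
      have h4 : Tendsto (fun n : ℕ => ((1 / 16 : ℝ)) ^ n) atTop (𝓝 0) :=
        tendsto_pow_atTop_nhds_zero_of_lt_one (by norm_num) (by norm_num)
      have h5 := h4.const_mul (K * (2 * D))
      rw [mul_zero] at h5
      refine h5.congr fun n => ?_
      rw [div_pow, one_pow]
      ring
    exact (h3.eventually_lt_const hε).mono fun n hn => ((hpq _).trans (h1 n)).trans_lt hn
  refine ⟨η, ?_, fun t => ?_⟩
  · rw [← hCη]
    simp [hC0]
  · have := (hC t).add (hasCurveDerivAt_const (1 : A) t)
    rw [add_zero, hCη] at this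
    exact this

theorem IsMackeyComplete.exists_isLeftEvolution [T2Space A] (hE : IsMackeyComplete A)
    (hA : IsLocallyMConvex A) {γ : I → A} (hγ : IsLipschitzCurve γ) :
    ∃ η, IsLeftEvolution γ η := by
  obtain ⟨η, h0, h⟩ := hE.exists_linearODE_solution hA hγ (isLipschitzCurve_const 0)
  exact ⟨η, h0, by simpa using h⟩

theorem IsLeftEvolution.continuous {γ η : I → A} (h : IsLeftEvolution γ η) : Continuous η :=
  continuous_of_hasCurveDerivAt h.deriv

/-- Grönwall's inequality for `(η - ζ)' = (η - ζ) γ + ζ (γ - δ)`. Taking `ε = 0` gives uniqueness,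
small `ε` gives continuous dependence; no bound on `η` is needed. -/
theorem IsLeftEvolution.seminorm_sub_le {γ δ η ζ : I → A} (hη : IsLeftEvolution γ η)
    (hζ : IsLeftEvolution δ ζ) {q : Seminorm ℝ A} (hq : Continuous q)
    (hmul : ∀ x y, q (x * y) ≤ q x * q y) {K L ε : ℝ} (hK : ∀ t, q (γ t) ≤ K)
    (hL : ∀ t, q (ζ t) ≤ L) (hε : ∀ t, q (γ t - δ t) ≤ ε) (t : I) :
    q (η t - ζ t) ≤ L * ε * Real.exp (K + 1) := by
  refine seminorm_curve_le_of_deriv_le_mul_add (fun s => (hη.deriv s).sub (hζ.deriv s)) hq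
    ((apply_nonneg q _).trans (hK 0))
    (mul_nonneg ((apply_nonneg q _).trans (hL 0)) ((apply_nonneg q _).trans (hε 0)))
    (by rw [hη.init, hζ.init, sub_self]) (fun s => ?_) t
  have e : η s * γ s - ζ s * δ s = (η s - ζ s) * γ s + ζ s * (γ s - δ s) := by noncomm_ring
  rw [e]
  refine (map_add_le_add q _ _).trans (add_le_add ?_ ?_)
  · rw [mul_comm K]
    exact (hmul _ _).trans (mul_le_mul_of_nonneg_left (hK s) (apply_nonneg q _))
  · exact (hmul _ _).trans (mul_le_mul (hL s) (hε s) (apply_nonneg q _)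
      ((apply_nonneg q _).trans (hL s)))

theorem IsLeftEvolution.unique [T2Space A] (hA : IsLocallyMConvex A) {γ η ζ : I → A}
    (hγ : Continuous γ) (hη : IsLeftEvolution γ η) (hζ : IsLeftEvolution γ ζ) : η = ζ := by
  funext t
  refine eq_of_forall_seminorm_sub_le_zero fun p hp => ?_
  obtain ⟨q, hq, hmul, hpq⟩ := hA p hp
  obtain ⟨K, -, hK⟩ := exists_seminorm_curve_le hγ hq
  obtain ⟨L, -, hL⟩ := exists_seminorm_curve_le hζ.continuous hq
  refine (hpq _).trans ((hη.seminorm_sub_le hζ hq hmul hK hL (ε := 0) (by simp) t).trans ?_)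
  simp

/-- Let `ζ' = -γ ζ`, `ζ 0 = 1`. The derivative of `η ζ` vanishes, so `η ζ = 1`. In the other order,
`u = ζ η - 1` satisfies `u' = u γ - γ u` and `u 0 = 0`, so `u = 0` by Grönwall. -/
theorem IsLeftEvolution.isUnit [T2Space A] (hE : IsMackeyComplete A) (hA : IsLocallyMConvex A)
    {γ η : I → A} (hγ : IsLipschitzCurve γ) (hη : IsLeftEvolution γ η) (t : I) :
    IsUnit (η t) := by
  have hγ' : IsLipschitzCurve fun t => -1 * γ t := (isLipschitzCurve_const _).mul hA hγ
  obtain ⟨ζ, hζ0, hζ⟩ := hE.exists_linearODE_solution hA (isLipschitzCurve_const 0) hγ'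
  have h1 : η t * ζ t = 1 := by
    have h0 := eq_of_hasCurveDerivAt_zero (a := 0) (b := t)
      (fun s => (hη.deriv s).mul (hζ s)) t.2.1 fun s _ _ => by noncomm_ring
    rwa [hη.init, hζ0, mul_one] at h0
  have h2 : ζ t * η t = 1 := by
    refine eq_of_forall_seminorm_sub_le_zero fun p hp => ?_
    obtain ⟨q, hq, hmul, hpq⟩ := hA p hp
    obtain ⟨K, hK0, hK⟩ := exists_seminorm_curve_le hγ.continuous hq
    refine (hpq _).trans ?_
    have := seminorm_curve_le_of_deriv_le_mul_add (K := K + K) (ε := 0)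
      (fun s => ((hζ s).mul (hη.deriv s)).sub (hasCurveDerivAt_const (1 : A) s)) hq
      (by positivity) le_rfl (by simp [hη.init, hζ0]) (fun s => ?_) t
    · simpa using this
    · have e : (ζ s * 0 + -1 * γ s * ζ s) * η s + ζ s * (η s * γ s) - 0 =
          (ζ s * η s - 1) * γ s + (-γ s) * (ζ s * η s - 1) := by noncomm_ring
      rw [e, add_zero]
      exact seminorm_mul_add_mul_le hmul (hK s) (by rw [map_neg_eq_map]; exact hK s)
  exact ⟨⟨η t, ζ t, h1, h2⟩, rfl⟩

end LinearODE

/-! ### The tangent algebra `A ⊕ Aε` -/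

section TangentAlgebra

open TrivSqZeroExt

variable {A : Type*} [Ring A] [Algebra ℝ A] [TopologicalSpace A]

/-- The base component of the tangent algebra, as a continuous real-linear map. -/
def tangentFst : TrivSqZeroExt A A →L[ℝ] A where
  toFun := fst
  map_add' _ _ := rfl
  map_smul' _ _ := rfl
  cont := TrivSqZeroExt.continuous_fst

/-- The tangent component of the tangent algebra, as a continuous real-linear map. -/
def tangentSnd : TrivSqZeroExt A A →L[ℝ] A where
  toFun := snd
  map_add' _ _ := rfl
  map_smul' _ _ := rfl
  cont := TrivSqZeroExt.continuous_snd

/-- The inclusion of the base into the tangent algebra, as a continuous real-linear map. -/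
def tangentInl : A →L[ℝ] TrivSqZeroExt A A where
  toFun := inl
  map_add' _ _ := by ext <;> simp
  map_smul' _ _ := by ext <;> simp
  cont := TrivSqZeroExt.continuous_inl

/-- The inclusion of the fibre into the tangent algebra, as a continuous real-linear map. -/
def tangentInr : A →L[ℝ] TrivSqZeroExt A A where
  toFun := inr
  map_add' _ _ := by ext <;> simp
  map_smul' _ _ := by ext <;> simp
  cont := TrivSqZeroExt.continuous_inr

instance [LocallyConvexSpace ℝ A] : LocallyConvexSpace ℝ (TrivSqZeroExt A A) :=
  inferInstanceAs (LocallyConvexSpace ℝ (A × A))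

theorem seminorm_tangent_le (p : Seminorm ℝ (TrivSqZeroExt A A)) (x : TrivSqZeroExt A A) :
    p x ≤ p (tangentInl x.fst) + p (tangentInr x.snd) := by
  conv_lhs => rw [← inl_fst_add_inr_snd_eq x]
  exact map_add_le_add p _ _

/-- For submultiplicative `q`, the sum `q x.fst + q x.snd` is submultiplicative: expanding the
product of two such sums gives the required terms and the nonnegative extra term `q x.snd * q
y.snd`. One `q` is chosen to dominate `p` on base and fibre together. -/
theorem IsLocallyMConvex.tangent (hA : IsLocallyMConvex A) :
    IsLocallyMConvex (TrivSqZeroExt A A) := by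
  intro p hp
  obtain ⟨q, hq, hmul, hpq⟩ := hA
    (p.comp (tangentInl (A := A)).toLinearMap + p.comp (tangentInr (A := A)).toLinearMap)
    ((hp.comp tangentInl.continuous).add (hp.comp tangentInr.continuous))
  refine ⟨q.comp (tangentFst (A := A)).toLinearMap + q.comp (tangentSnd (A := A)).toLinearMap,
    (hq.comp tangentFst.continuous).add (hq.comp tangentSnd.continuous), fun x y => ?_,
    fun x => ?_⟩
  · change q (x * y).fst + q (x * y).snd ≤ (q x.fst + q x.snd) * (q y.fst + q y.snd)
    rw [fst_mul, snd_mul, smul_eq_mul, op_smul_eq_mul]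
    have h1 := hmul x.fst y.fst
    have h2 := hmul x.fst y.snd
    have h3 := hmul x.snd y.fst
    have h4 := map_add_le_add q (x.fst * y.snd) (x.snd * y.fst)
    have h5 := mul_nonneg (apply_nonneg q x.snd) (apply_nonneg q y.snd)
    linarith
  · have h1 : p (tangentInl x.fst) + p (tangentInr x.fst) ≤ q x.fst := hpq x.fst
    have h2 : p (tangentInl x.snd) + p (tangentInr x.snd) ≤ q x.snd := hpq x.snd
    have h3 := apply_nonneg p (tangentInr x.fst)
    have h4 := apply_nonneg p (tangentInl x.snd)
    change p x ≤ q x.fst + q x.snd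
    linarith [seminorm_tangent_le p x]

theorem IsMackeyComplete.tangent [IsTopologicalRing A] [ContinuousSMul ℝ A]
    [LocallyConvexSpace ℝ A] (hE : IsMackeyComplete A) :
    IsMackeyComplete (TrivSqZeroExt A A) := by
  intro γ hγ
  have hcomp : ∀ L : TrivSqZeroExt A A →L[ℝ] A, IsLipschitzCurve fun t => L (γ t) := by
    intro L
    refine isLipschitzCurve_iff.2 fun p hp => ?_
    obtain ⟨M, hM⟩ := isLipschitzCurve_iff.1 hγ (p.comp L.toLinearMap) (hp.comp L.continuous)
    refine ⟨M, fun s t => ?_⟩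
    rw [← map_sub]
    exact hM s t
  obtain ⟨J₁, hJ₁⟩ := hE _ (hcomp tangentFst)
  obtain ⟨J₂, hJ₂⟩ := hE _ (hcomp tangentSnd)
  refine ⟨inl J₁ + inr J₂, fun U hU => ?_⟩
  rw [TrivSqZeroExt.nhds_def] at hU
  simp only [fst_add, fst_inl, fst_inr, add_zero, snd_add, snd_inl, snd_inr, zero_add] at hU
  obtain ⟨U₁, hU₁, U₂, hU₂, hU⟩ := mem_prod_iff.1 hU
  obtain ⟨δ₁, hδ₁, H₁⟩ := hJ₁ U₁ hU₁
  obtain ⟨δ₂, hδ₂, H₂⟩ := hJ₂ U₂ hU₂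
  refine ⟨min δ₁ δ₂, lt_min hδ₁ hδ₂, fun n x ξ h0 h1 h => hU ⟨?_, ?_⟩⟩
  · have := H₁ n x ξ h0 h1 fun i hi =>
      ⟨(h i hi).1, (h i hi).2.1, (h i hi).2.2.trans_le (min_le_left _ _)⟩
    have e := map_sum (tangentFst (A := A))
      (fun i => ((x (i + 1) : ℝ) - x i) • γ (ξ i)) (Finset.range n)
    simp only [map_smul] at e
    rw [← e] at this
    exact this
  · have := H₂ n x ξ h0 h1 fun i hi =>
      ⟨(h i hi).1, (h i hi).2.1, (h i hi).2.2.trans_le (min_le_right _ _)⟩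
    have e := map_sum (tangentSnd (A := A))
      (fun i => ((x (i + 1) : ℝ) - x i) • γ (ξ i)) (Finset.range n)
    simp only [map_smul] at e
    rw [← e] at this
    exact this

theorem isLipschitzCurve_tangent [IsTopologicalRing A] [ContinuousSMul ℝ A]
    [LocallyConvexSpace ℝ A] {γ δ : I → A} (hγ : IsLipschitzCurve γ) (hδ : IsLipschitzCurve δ) :
    IsLipschitzCurve fun t => tangentInl (γ t) + tangentInr (δ t) := by
  refine IsLipschitzCurve.add ?_ ?_ <;> refine isLipschitzCurve_iff.2 fun p hp => ?_
  · obtain ⟨M, hM⟩ := isLipschitzCurve_iff.1 hγ (p.comp (tangentInl (A := A)).toLinearMap)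
      (hp.comp tangentInl.continuous)
    exact ⟨M, fun s t => by rw [← map_sub]; exact hM s t⟩
  · obtain ⟨M, hM⟩ := isLipschitzCurve_iff.1 hδ (p.comp (tangentInr (A := A)).toLinearMap)
      (hp.comp tangentInr.continuous)
    exact ⟨M, fun s t => by rw [← map_sub]; exact hM s t⟩

/-- The tangent component of an evolution in the tangent algebra solves the variational equation. -/
theorem IsLeftEvolution.tangent {γ δ : I → A} {H : I → TrivSqZeroExt A A}
    (hH : IsLeftEvolution (fun t => tangentInl (γ t) + tangentInr (δ t)) H) :
    IsLeftEvolution γ (fun t => (H t).fst) ∧ (H 0).snd = 0 ∧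
      ∀ t, HasCurveDerivAt (fun s => (H s).snd) ((H t).fst * δ t + (H t).snd * γ t) t := by
  refine ⟨⟨by simp [hH.init], fun t => ?_⟩, by simp [hH.init], fun t => ?_⟩
  · have : HasCurveDerivAt (fun s => (H s).fst) ((H t).fst * (γ t + 0)) t :=
      (hH.deriv t).clm_comp (tangentFst (A := A))
    rwa [add_zero] at this
  · have : HasCurveDerivAt (fun s => (H s).snd)
        ((H t).fst * (0 + δ t) + (H t).snd * (γ t + 0)) t :=
      (hH.deriv t).clm_comp (tangentSnd (A := A))
    rwa [add_zero, zero_add] at this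

end TangentAlgebra

/-! ### Continuous and smooth dependence of the evolution on the curve -/

section SmoothEvolution

theorem IsLeftEvolution.eventually_seminorm_sub_lt {A ι : Type*} [Ring A] [Algebra ℝ A]
    [TopologicalSpace A] [IsTopologicalRing A] [ContinuousSMul ℝ A]
    [LocallyConvexSpace ℝ A] {l : Filter ι}
    {γ η : I → A} {δ ζ : ι → I → A} (hγ : Continuous γ)
    (hη : IsLeftEvolution γ η) (hζ : ∀ i, IsLeftEvolution (δ i) (ζ i)) {q : Seminorm ℝ A}
    (hq : Continuous q) (hmul : ∀ x y, q (x * y) ≤ q x * q y)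
    (h : ∀ ε, 0 < ε → ∀ᶠ i in l, ∀ t, q (δ i t - γ t) < ε) {ε : ℝ} (hε : 0 < ε) :
    ∀ᶠ i in l, ∀ t, q (ζ i t - η t) < ε := by
  obtain ⟨K, hK0, hK⟩ := exists_seminorm_curve_le hγ hq
  obtain ⟨L, hL0, hL⟩ := exists_seminorm_curve_le hη.continuous hq
  set D := (L + 1) * Real.exp (K + 1 + 1) with hD
  have hD0 : 0 < D := by positivity
  -- The bound `1` keeps `q (δ i t) ≤ K + 1`, so that a single Grönwall constant serves all nearby
  -- curves.
  have hε' : 0 < min 1 (ε / D) := lt_min one_pos (div_pos hε hD0)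
  filter_upwards [h _ hε'] with i hi t
  have h1 := (hζ i).seminorm_sub_le hη hq hmul (K := K + 1) (fun s => ?_) hL
    (fun s => (hi s).le) t
  · refine h1.trans_lt ?_
    have hexp := Real.exp_pos (K + 1 + 1)
    calc L * min 1 (ε / D) * Real.exp (K + 1 + 1)
        < (L + 1) * min 1 (ε / D) * Real.exp (K + 1 + 1) := by
          refine mul_lt_mul_of_pos_right ?_ hexp
          exact mul_lt_mul_of_pos_right (lt_add_one L) hε'
      _ = D * min 1 (ε / D) := by
          rw [hD]
          ring
      _ ≤ D * (ε / D) := mul_le_mul_of_nonneg_left (min_le_right _ _) hD0.le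
      _ = ε := mul_div_cancel₀ ε hD0.ne'
  · have h2 := map_add_le_add q (δ i s - γ s) (γ s)
    rw [sub_add_cancel] at h2
    linarith [hK s, (hi s).trans_le (min_le_left _ _)]

universe u v

/-- If the curves `Γ x` depend linearly and continuously on `x`, then the end point of their
evolution is a `C^n` function of `x`, for each `n`. -/
theorem contDirDiffOn_evolution (n : ℕ) {V : Type u} {A : Type v} [AddCommGroup V] [Module ℝ V]
    [TopologicalSpace V] [IsTopologicalAddGroup V] [ContinuousSMul ℝ V] [Ring A] [Algebra ℝ A]
    [TopologicalSpace A] [IsTopologicalRing A] [ContinuousSMul ℝ A] [LocallyConvexSpace ℝ A]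
    [T2Space A] (hE : IsMackeyComplete A) (hA : IsLocallyMConvex A) (Γ : V →ₗ[ℝ] (I → A))
    (hL : ∀ x, IsLipschitzCurve (Γ x))
    (hΓ : ∀ p : Seminorm ℝ A, Continuous p → ∀ ε, 0 < ε → ∀ᶠ x in 𝓝 0, ∀ t, p (Γ x t) < ε)
    {f : V → A} (hf : ∀ x, ∃ η, IsLeftEvolution (Γ x) η ∧ η 1 = f x) :
    ContDirDiffOn A n f univ := by
  choose η hη hη1 using hf
  have hclose : ∀ (x : V) (q : Seminorm ℝ A), Continuous q → (∀ a b, q (a * b) ≤ q a * q b) →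
      ∀ ε, 0 < ε → ∀ᶠ y in 𝓝 x, ∀ t, q (η y t - η x t) < ε := by
    intro x q hq hmul ε hε
    refine (hη x).eventually_seminorm_sub_lt (hL x).continuous hη hq hmul (fun ε hε => ?_) hε
    have h1 : Tendsto (fun y => y - x) (𝓝 x) (𝓝 0) := by
      have hc : Continuous fun y => y - x := by fun_prop
      simpa using hc.tendsto x
    refine (h1.eventually (hΓ q hq ε hε)).mono fun y hy t => ?_
    simpa using hy t
  have hcont : Continuous f := by
    refine continuous_iff_continuousAt.2 fun x => tendsto_nhds_iff_seminorm.2 fun p hp ε hε => ?_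
    obtain ⟨q, hq, hmul, hpq⟩ := hA p hp
    refine (hclose x q hq hmul ε hε).mono fun y hy => ?_
    rw [← hη1, ← hη1]
    exact (hpq _).trans_lt (hy 1)
  cases n with
  | zero => exact hcont.continuousOn
  | succ n =>
    -- The family `Γ x + ε Γ y` is again linear in its parameter `(x, y)`, so the theorem at order
    -- `n` applies to it. This is why an arbitrary parameter space `V` and linear family `Γ` are
    -- allowed.
    let Γ' : V × V →ₗ[ℝ] (I → TrivSqZeroExt A A) :=
      { toFun := fun z t => tangentInl (Γ z.1 t) + tangentInr (Γ z.2 t)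
        map_add' := fun z w => by
          funext t
          simp only [Prod.fst_add, Prod.snd_add, map_add, Pi.add_apply]
          abel
        map_smul' := fun c z => by
          funext t
          simp only [Prod.smul_fst, Prod.smul_snd, map_smul, Pi.smul_apply, smul_add,
            RingHom.id_apply] }
    have hL' : ∀ z, IsLipschitzCurve (Γ' z) := fun z => isLipschitzCurve_tangent (hL _) (hL _)
    have hΓ' : ∀ p : Seminorm ℝ (TrivSqZeroExt A A), Continuous p → ∀ ε, 0 < ε →
        ∀ᶠ z in 𝓝 0, ∀ t, p (Γ' z t) < ε := by
      intro p hp ε hε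
      have h1 := hΓ (p.comp (tangentInl (A := A)).toLinearMap) (hp.comp tangentInl.continuous)
        _ (half_pos hε)
      have h2 := hΓ (p.comp (tangentInr (A := A)).toLinearMap) (hp.comp tangentInr.continuous)
        _ (half_pos hε)
      filter_upwards [(continuous_fst.tendsto (0 : V × V)).eventually h1,
        (continuous_snd.tendsto (0 : V × V)).eventually h2] with z hz1 hz2 t
      have h3 : p (tangentInl (Γ z.1 t)) < ε / 2 := hz1 t
      have h4 : p (tangentInr (Γ z.2 t)) < ε / 2 := hz2 t
      exact (map_add_le_add p _ _).trans_lt (by linarith)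
    have hex : ∀ z, ∃ H, IsLeftEvolution (Γ' z) H := fun z =>
      hE.tangent.exists_isLeftEvolution hA.tangent (hL' z)
    choose H hH using hex
    refine ⟨hcont.continuousOn, fun z => tangentSnd (H z 1), fun x _ y => ?_,
      (contDirDiffOn_evolution n hE.tangent hA.tangent Γ' hL' hΓ' (f := fun z => H z 1)
        fun z => ⟨H z, hH z, rfl⟩).clm_comp tangentSnd |>.mono (subset_univ _)⟩
    obtain ⟨h1, h0, h2⟩ := (hH (x, y)).tangent
    have hfst : ∀ t, (H (x, y) t).fst = η x t :=
      congrFun (h1.unique hA (hL x).continuous (hη x))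
    simp only [hfst] at h2
    refine tendsto_nhds_iff_seminorm.2 fun p hp ε hε => ?_
    obtain ⟨q, hq, hmul, hpq⟩ := hA p hp
    obtain ⟨K, hK0, hK⟩ := exists_seminorm_curve_le (hL x).continuous hq
    obtain ⟨D, hD0, hD⟩ := exists_seminorm_curve_le (hL y).continuous hq
    set B := (D + 1) * Real.exp (K + 1) with hB
    have hB0 : 0 < B := by positivity
    have hε' : 0 < ε / B := div_pos hε hB0
    filter_upwards [(tendsto_add_smul_punctured x y).eventually (hclose x q hq hmul _ hε'),
      self_mem_nhdsWithin] with h hh hh0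
    have hh0 : h ≠ 0 := hh0
    -- The error `u` of the difference quotient starts at `0` and, by linearity of `Γ`, satisfies
    -- exactly `u' = u Γ(x) + (η_{x+hy} - η_x) Γ(y)`. The forcing term is uniformly small by
    -- continuous dependence.
    have key := seminorm_curve_le_of_deriv_le_mul_add (K := K) (ε := ε / B * D)
      (fun t => ((((hη (x + h • y)).deriv t).sub ((hη x).deriv t)).const_smul h⁻¹).sub (h2 t))
      hq hK0 (by positivity) (by rw [(hη _).init, (hη x).init, h0]; simp) (fun t => ?_) 1
    · rw [← hη1, ← hη1]
      refine (hpq _).trans_lt (key.trans_lt ?_)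
      calc ε / B * D * Real.exp (K + 1) < ε / B * (D + 1) * Real.exp (K + 1) := by
            refine mul_lt_mul_of_pos_right ?_ (Real.exp_pos _)
            exact mul_lt_mul_of_pos_left (lt_add_one D) hε'
        _ = ε / B * B := by
            rw [hB]
            ring
        _ = ε := div_mul_cancel₀ ε hB0.ne'
    · have e : h⁻¹ • (η (x + h • y) t * Γ (x + h • y) t - η x t * Γ x t) -
          (η x t * Γ y t + (H (x, y) t).snd * Γ x t) =
          (h⁻¹ • (η (x + h • y) t - η x t) - (H (x, y) t).snd) * Γ x t +
            (η (x + h • y) t - η x t) * Γ y t := by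
        have e1 : η (x + h • y) t * Γ (x + h • y) t - η x t * Γ x t =
            (η (x + h • y) t - η x t) * Γ x t + h • (η (x + h • y) t * Γ y t) := by
          rw [map_add, map_smul, Pi.add_apply, Pi.smul_apply, mul_add, mul_smul_comm, sub_mul]
          abel
        rw [e1, smul_add, inv_smul_smul₀ hh0, ← smul_mul_assoc, sub_mul _ _ (Γ x t),
          sub_mul _ _ (Γ y t)]
        abel
      rw [e]
      refine (map_add_le_add q _ _).trans (add_le_add ?_ ?_)
      · rw [mul_comm K]
        exact (hmul _ _).trans (mul_le_mul_of_nonneg_left (hK t) (apply_nonneg q _))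
      · exact (hmul _ _).trans (mul_le_mul (hh t).le (hD t) (apply_nonneg q _) hε'.le)

end SmoothEvolution

/-! ### From condition `(*)` to submultiplicative seminorms -/

section LocallyMConvex

open scoped Pointwise

theorem Seminorm.le_gauge_of_forall_le_one {E : Type*} [AddCommGroup E] [Module ℝ E]
    (p : Seminorm ℝ E) {s : Set E} (hs : Absorbent ℝ s) (h : ∀ x ∈ s, p x ≤ 1) (x : E) :
    p x ≤ gauge s x := by
  refine le_of_forall_gt fun a ha => ?_
  obtain ⟨b, hb, hba, y, hy, rfl⟩ := exists_lt_of_gauge_lt hs ha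
  refine lt_of_le_of_lt ?_ hba
  change p (b • y) ≤ b
  rw [map_smul_eq_mul, Real.norm_eq_abs, abs_of_pos hb]
  exact mul_le_of_le_one_right hb.le (h y hy)

/-- A continuous real seminorm on a topological `𝕜`-vector space is dominated by a continuous
`𝕜`-seminorm. -/
theorem exists_continuous_seminorm_ge {𝕜 E : Type*} [RCLike 𝕜] [AddCommGroup E] [Module 𝕜 E]
    [Module ℝ E] [IsScalarTower ℝ 𝕜 E] [TopologicalSpace E] [IsTopologicalAddGroup E]
    [ContinuousSMul 𝕜 E] [ContinuousSMul ℝ E] (p : Seminorm ℝ E) (hp : Continuous p) :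
    ∃ q : Seminorm 𝕜 E, Continuous q ∧ ∀ x, p x ≤ q x := by
  -- This is the unit ball of `x ↦ sup {p (a x) : ‖a‖ ≤ 1}`. It is a neighbourhood of `0` because it
  -- contains the `𝕜`-balanced core of the unit ball of `p`.
  set V : Set E := {x | ∀ a : 𝕜, ‖a‖ ≤ 1 → p (a • x) ≤ 1} with hV
  have hU : {x : E | p x ≤ 1} ∈ 𝓝 0 := by
    have : {x : E | p x < 1} ∈ 𝓝 0 :=
      (isOpen_lt hp continuous_const).mem_nhds (by simp)
    exact mem_of_superset this fun x hx => show p x ≤ 1 from le_of_lt hx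
  have hVn : V ∈ 𝓝 0 := mem_of_superset (balancedCore_mem_nhds_zero (𝕜 := 𝕜) hU) fun x hx a ha =>
    show a • x ∈ {x : E | p x ≤ 1} from balancedCore_subset (𝕜 := 𝕜) _
      ((balancedCore_balanced (𝕜 := 𝕜) {x : E | p x ≤ 1}).smul_mem ha hx)
  have hVb : Balanced 𝕜 V := by
    rw [balanced_iff_smul_mem]
    intro b hb x hx a ha
    rw [smul_smul]
    exact hx _ (by rw [norm_mul]; exact mul_le_one₀ ha (norm_nonneg b) hb)
  have hVc : Convex ℝ V := by
    intro x hx y hy s t hs ht hst a ha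
    rw [smul_add, smul_comm a s, smul_comm a t]
    refine (map_add_le_add p _ _).trans ?_
    rw [map_smul_eq_mul p s, map_smul_eq_mul p t, Real.norm_of_nonneg hs, Real.norm_of_nonneg ht,
      ← hst]
    exact add_le_add (mul_le_of_le_one_right hs (hx a ha)) (mul_le_of_le_one_right ht (hy a ha))
  have hVa : Absorbent ℝ V := absorbent_nhds_zero hVn
  refine ⟨gaugeSeminorm hVb hVc hVa, continuous_gauge hVc hVn, fun x => ?_⟩
  exact p.le_gauge_of_forall_le_one hVa (fun y hy => by simpa using hy 1 (by simp)) x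

/-- If `x = a u` and `y = b v` with `u, v ∈ s` and `a`, `b` within `ε` of the gauges, then `x y = a
b (u v)` has gauge at most `a b`; let `ε → 0`. -/
theorem gauge_mul_le {A : Type*} [Ring A] [Algebra ℝ A] {s : Set A} (hs : Absorbent ℝ s)
    (hmul : ∀ x ∈ s, ∀ y ∈ s, x * y ∈ s) (x y : A) : gauge s (x * y) ≤ gauge s x * gauge s y := by
  have key : ∀ ε : ℝ, 0 < ε → gauge s (x * y) ≤ (gauge s x + ε) * (gauge s y + ε) := by
    intro ε hε
    obtain ⟨a, ha0, ha, u, hu, rfl⟩ :=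
      exists_lt_of_gauge_lt hs (lt_add_of_pos_right (gauge s x) hε)
    obtain ⟨b, hb0, hb, v, hv, rfl⟩ :=
      exists_lt_of_gauge_lt hs (lt_add_of_pos_right (gauge s y) hε)
    refine le_trans ?_ (mul_le_mul ha.le hb.le hb0.le (ha0.le.trans ha.le))
    refine gauge_le_of_mem (by positivity) ⟨u * v, hmul u hu v hv, ?_⟩
    simp [smul_smul, mul_comm]
  have hlim : Tendsto (fun ε : ℝ => (gauge s x + ε) * (gauge s y + ε)) (𝓝[>] 0)
      (𝓝 (gauge s x * gauge s y)) := by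
    have hc : Continuous fun ε : ℝ => (gauge s x + ε) * (gauge s y + ε) := by fun_prop
    have := (hc.tendsto 0).mono_left (nhdsWithin_le_nhds (s := Ioi 0))
    simpa using this
  exact ge_of_tendsto hlim (eventually_nhdsWithin_of_forall key)

/-- If all products of elements of a balanced neighbourhood of `0` lie in the unit ball of `p`, then
`p` is dominated by a continuous submultiplicative seminorm. -/
theorem exists_submultiplicative_seminorm_ge {A : Type*} [Ring A] [Algebra ℝ A]
    [TopologicalSpace A] [IsTopologicalRing A] [ContinuousSMul ℝ A] (p : Seminorm ℝ A) {U : Set A}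
    (hU : U ∈ 𝓝 0) (hUb : Balanced ℝ U)
    (h : ∀ l : List A, l ≠ [] → (∀ x ∈ l, x ∈ U) → p l.prod ≤ 1) :
    ∃ q : Seminorm ℝ A, Continuous q ∧ (∀ x y, q (x * y) ≤ q x * q y) ∧ ∀ x, p x ≤ q x := by
  -- The empty product is excluded: `p 1 ≤ 1` is not available, and balancedness of `S` is obtained
  -- by absorbing the scalar into the first factor.
  set S : Set A := {x | ∃ l : List A, l ≠ [] ∧ (∀ y ∈ l, y ∈ U) ∧ l.prod = x} with hS
  have hUS : U ⊆ S := fun x hx => ⟨[x], by simp, by simpa using hx, by simp⟩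
  have hSb : Balanced ℝ S := by
    rw [balanced_iff_smul_mem]
    rintro a ha _ ⟨l, hl, hlU, rfl⟩
    obtain ⟨x, l, rfl⟩ := List.exists_cons_of_ne_nil hl
    refine ⟨(a • x) :: l, by simp, ?_, by simp⟩
    simp only [List.mem_cons, forall_eq_or_imp] at hlU ⊢
    exact ⟨hUb.smul_mem ha hlU.1, hlU.2⟩
  have hSm : ∀ x ∈ S, ∀ y ∈ S, x * y ∈ S := by
    rintro _ ⟨l, hl, hlU, rfl⟩ _ ⟨m, -, hmU, rfl⟩
    refine ⟨l ++ m, by simp [hl], ?_, by simp⟩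
    simp only [List.mem_append]
    rintro x (hx | hx)
    exacts [hlU x hx, hmU x hx]
  have hWc : Convex ℝ (convexHull ℝ S) := convex_convexHull ℝ S
  -- Closure under products passes to the convex hull one factor at a time, since left and right
  -- multiplications are linear.
  have hWm : ∀ x ∈ convexHull ℝ S, ∀ y ∈ convexHull ℝ S, x * y ∈ convexHull ℝ S := by
    have h1 : ∀ x ∈ S, ∀ y ∈ convexHull ℝ S, x * y ∈ convexHull ℝ S := fun x hx =>
      convexHull_min (fun y hy => subset_convexHull ℝ S (hSm x hx y hy))
        (hWc.linear_preimage (LinearMap.mulLeft ℝ x))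
    intro x hx y hy
    exact convexHull_min (fun z hz => h1 z hz y hy)
      (hWc.linear_preimage (LinearMap.mulRight ℝ y)) hx
  have hWn : convexHull ℝ S ∈ 𝓝 0 :=
    mem_of_superset hU (hUS.trans (subset_convexHull ℝ S))
  have hWa : Absorbent ℝ (convexHull ℝ S) := absorbent_nhds_zero hWn
  have hWp : ∀ x ∈ convexHull ℝ S, p x ≤ 1 := by
    have hp : Convex ℝ {x : A | p x ≤ 1} := by
      simpa [Seminorm.closedBall_zero_eq] using p.convex_closedBall 0 1
    refine fun x hx => convexHull_min ?_ hp hx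
    rintro _ ⟨l, hl, hlU, rfl⟩
    exact h l hl hlU
  exact ⟨gaugeSeminorm (𝕜 := ℝ) hSb.convexHull hWc hWa, continuous_gauge hWc hWn,
    gauge_mul_le hWa hWm, p.le_gauge_of_forall_le_one hWa hWp⟩

theorem List.prod_map_smul_eq_pow_smul {𝕜 A : Type*} [CommRing 𝕜] [Ring A] [Algebra 𝕜 A] (c : 𝕜)
    (l : List A) : (l.map (c • ·)).prod = c ^ l.length • l.prod := by
  induction l with
  | nil => simp
  | cons x l ih => simp [ih, pow_succ', smul_smul, mul_comm]

/-- Condition `(*)` implies that the topology is defined by submultiplicative seminorms. -/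
theorem ConditionStar.isLocallyMConvex {𝕜 A : Type*} [RCLike 𝕜] [Ring A] [Algebra 𝕜 A]
    [Algebra ℝ A] [IsScalarTower ℝ 𝕜 A] [TopologicalSpace A] [IsTopologicalRing A]
    [ContinuousSMul 𝕜 A] [ContinuousSMul ℝ A] (h : ConditionStar 𝕜 A) : IsLocallyMConvex A := by
  intro p hp
  obtain ⟨P, hP, hpP⟩ := exists_continuous_seminorm_ge (𝕜 := 𝕜) p hp
  obtain ⟨q, hq, r, hr, hsum⟩ := h P hP
  set T := ∑' n : ℕ, ENNReal.ofReal r ^ (n + 1) * mulSeminorm (n + 1) P q with hT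
  -- Each term of the series is at most `M`. For `n ≥ 1` factors in the `q`-ball of radius `r / M`,
  -- rescaling to the unit ball gives `M ^ n * P (x₁ ⋯ x_n) ≤ M`, and `M ≥ 1` then yields `P (x₁ ⋯
  -- x_n) ≤ 1`.
  set M : ℝ := max T.toReal 1 with hM
  have hM1 : 1 ≤ M := le_max_right _ _
  have hM0 : 0 < M := one_pos.trans_le hM1
  have hball : ∀ l : List A, l ≠ [] → (∀ x ∈ l, q x ≤ 1) → r ^ l.length * P l.prod ≤ M := by
    intro l hl hlq
    obtain ⟨n, hn⟩ : ∃ n, l.length = n + 1 :=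
      Nat.exists_eq_succ_of_ne_zero (by simpa using hl)
    have h1 : ENNReal.ofReal (P l.prod) ≤ mulSeminorm (n + 1) P q := by
      rw [← hn]
      refine le_iSup₂_of_le l.get (fun i => hlq _ (List.get_mem l i)) ?_
      rw [List.ofFn_get]
    have h2 : ENNReal.ofReal (r ^ (n + 1) * P l.prod) ≤ T := by
      rw [ENNReal.ofReal_mul (by positivity), ENNReal.ofReal_pow hr.le]
      exact (mul_le_mul_right h1 _).trans
        (ENNReal.le_tsum (f := fun n => ENNReal.ofReal r ^ (n + 1) * mulSeminorm (n + 1) P q) n)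
    rw [hn]
    exact ((ENNReal.ofReal_le_iff_le_toReal hsum.ne).1 h2).trans (le_max_left _ _)
  have hc0 : 0 < r / M := div_pos hr hM0
  have hsmul : ∀ (a : ℝ) (x : A), q (a • x) = |a| * q x := by
    intro a x
    rw [← algebraMap_smul 𝕜 a x, map_smul_eq_mul, norm_algebraMap', Real.norm_eq_abs]
  refine exists_submultiplicative_seminorm_ge p (U := {x | q x ≤ r / M}) ?_ ?_ ?_
  · have : {x : A | q x < r / M} ∈ 𝓝 0 :=
      (isOpen_lt hq continuous_const).mem_nhds (by simpa using hc0)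
    exact mem_of_superset this fun x hx => show q x ≤ r / M from le_of_lt hx
  · rw [balanced_iff_smul_mem]
    intro a ha x hx
    change q (a • x) ≤ r / M
    rw [hsmul]
    exact (mul_le_of_le_one_left (apply_nonneg q x) ha).trans hx
  · intro l hl hlU
    have h1 := hball (l.map ((r / M)⁻¹ • ·)) (by simpa using hl) fun x hx => by
      obtain ⟨y, hy, rfl⟩ := List.mem_map.1 hx
      rw [hsmul, abs_of_pos (inv_pos.2 hc0), inv_mul_le_iff₀ hc0, mul_one]
      exact hlU y hy
    have hPs : ∀ (a : ℝ) (x : A), P (a • x) = |a| * P x := by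
      intro a x
      rw [← algebraMap_smul 𝕜 a x, map_smul_eq_mul, norm_algebraMap', Real.norm_eq_abs]
    rw [List.prod_map_smul_eq_pow_smul, hPs, List.length_map, abs_of_pos (by positivity),
      ← mul_assoc, ← mul_pow] at h1
    have h2 : r * (r / M)⁻¹ = M := by field_simp
    rw [h2] at h1
    have h3 : M ≤ M ^ l.length := le_self_pow₀ hM1 (by simpa using hl)
    have h4 : M * P l.prod ≤ M * 1 := by
      rw [mul_one]
      exact (mul_le_mul_of_nonneg_right h3 (apply_nonneg P _)).trans h1
    exact (hpP _).trans (le_of_mul_le_mul_left h4 hM0)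

end LocallyMConvex

/-! ### The unit group as a Lie group with one chart -/

section UnitGroup

variable {A : Type*} [Ring A] [TopologicalSpace A] [IsContinuousInverseAlgebra A]

theorem eq_of_mem_atlas_units {e : OpenPartialHomeomorph Aˣ A} (he : e ∈ atlas A Aˣ) :
    (e : Aˣ → A) = Units.val ∧ e.source = univ ∧ e.target = {x | IsUnit x} := by
  have h := isOpenEmbedding_unitsVal_of_cia A
  have : e = h.toOpenPartialHomeomorph Units.val :=
    OpenPartialHomeomorph.singletonChartedSpace_mem_atlas_eq _
      (h.toOpenPartialHomeomorph_source Units.val) e he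
  subst this
  refine ⟨rfl, rfl, ?_⟩
  rw [h.toOpenPartialHomeomorph_target]
  rfl

theorem val_symm_of_mem_atlas_units {e : OpenPartialHomeomorph Aˣ A} (he : e ∈ atlas A Aˣ) {x : A}
    (hx : IsUnit x) : ((e.symm x : Aˣ) : A) = x := by
  obtain ⟨h1, -, h3⟩ := eq_of_mem_atlas_units he
  have := e.right_inv (show x ∈ e.target by rw [h3]; exact hx)
  rwa [h1] at this

theorem chartAt_units (u : Aˣ) : (chartAt A u : Aˣ → A) = Units.val :=
  (eq_of_mem_atlas_units (chart_mem_atlas A u)).1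

variable [Algebra ℝ A] [IsTopologicalRing A] [ContinuousSMul ℝ A] [LocallyConvexSpace ℝ A]
  [T2Space A]

/-- The unit group of a continuous inverse algebra is a Lie group. -/
theorem isLCLieGroup_units : IsLCLieGroup A Aˣ where
  toIsTopologicalGroup := inferInstance
  toT2Space := (isOpenEmbedding_unitsVal_of_cia A).isEmbedding.t2Space
  smooth_chart_change e he e' he' := by
    obtain ⟨-, -, h3⟩ := eq_of_mem_atlas_units he
    obtain ⟨h1, h2, -⟩ := eq_of_mem_atlas_units he'
    simp only [h1, h2, h3, mem_univ, and_true, mem_ofPred_eq]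
    refine (smoothOnOpen_of_contDirDiffOn (f := ContinuousLinearMap.id ℝ A)
      IsContinuousInverseAlgebra.isOpen_units
      fun n => ContinuousLinearMap.contDirDiffOn _ n _).congr fun x hx => ?_
    exact val_symm_of_mem_atlas_units he hx
  smooth_mul e₁ he₁ e₂ he₂ e₃ he₃ := by
    obtain ⟨-, -, h1⟩ := eq_of_mem_atlas_units he₁
    obtain ⟨-, -, h2⟩ := eq_of_mem_atlas_units he₂
    obtain ⟨h3, h3', -⟩ := eq_of_mem_atlas_units he₃
    simp only [h1, h2, h3, h3', mem_univ, and_true, mem_ofPred_eq]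
    have hopen : IsOpen {z : A × A | IsUnit z.1 ∧ IsUnit z.2} :=
      (IsContinuousInverseAlgebra.isOpen_units (A := A)).prod
        (IsContinuousInverseAlgebra.isOpen_units (A := A))
    refine (smoothOnOpen_of_contDirDiffOn (f := fun z : A × A => z.1 * z.2) hopen fun n =>
      ((ContinuousLinearMap.fst ℝ A A).contDirDiffOn n _).mul
        ((ContinuousLinearMap.snd ℝ A A).contDirDiffOn n _)).congr fun z hz => ?_
    change ((e₁.symm z.1 * e₂.symm z.2 : Aˣ) : A) = z.1 * z.2
    rw [Units.val_mul, val_symm_of_mem_atlas_units he₁ hz.1, val_symm_of_mem_atlas_units he₂ hz.2]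
  smooth_inv e he e' he' := by
    obtain ⟨-, -, h3⟩ := eq_of_mem_atlas_units he
    obtain ⟨h1, h2, -⟩ := eq_of_mem_atlas_units he'
    simp only [h1, h2, h3, mem_univ, and_true, mem_ofPred_eq]
    refine (smoothOnOpen_of_contDirDiffOn IsContinuousInverseAlgebra.isOpen_units
      contDirDiffOn_ringInverse).congr fun x hx => ?_
    change (((e.symm x)⁻¹ : Aˣ) : A) = Ring.inverse x
    rw [← Ring.inverse_unit, val_symm_of_mem_atlas_units he hx]

/-- Near `1`, left translation by `g` read in the chart is the restriction of the linear map `x ↦ g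
x`, which is its own derivative. -/
theorem isLeftTranslate_units_iff {g : Aˣ} {v w : A} :
    IsLeftTranslate g v w ↔ w = g * v := by
  have h1 : HasDirDerivAt (fun x : A => chartAt A g (g * (chartAt A (1 : Aˣ)).symm x)) (g * v)
      (chartAt A (1 : Aˣ) 1) v := by
    have h2 : HasDirDerivAt (fun x : A => (g : A) * x) (g * v) 1 v := by
      refine tendsto_const_nhds.congr' ?_
      filter_upwards [self_mem_nhdsWithin] with t ht
      rw [← mul_sub, add_sub_cancel_left, mul_smul_comm, inv_smul_smul₀ ht]
    rw [chartAt_units, chartAt_units]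
    refine h2.congr_of_eventuallyEq ?_
    filter_upwards [(IsContinuousInverseAlgebra.isOpen_units (A := A)).mem_nhds isUnit_one]
      with x hx
    rw [Units.val_mul, val_symm_of_mem_atlas_units (chart_mem_atlas A 1) hx]
  exact ⟨fun h => HasDirDerivAt.unique h h1, fun h => h ▸ h1⟩

theorem isEvolution_units_iff {γ : I → A} (hγ : Continuous γ) {η : I → Aˣ} :
    IsEvolution γ η ↔ IsLeftEvolution γ fun t => (η t : A) := by
  constructor
  · rintro ⟨-, h0, h⟩
    refine ⟨by rw [h0, Units.val_one], fun t => ?_⟩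
    obtain ⟨w, hw, hwt⟩ := h t
    rw [isLeftTranslate_units_iff] at hwt
    rw [chartAt_units, hwt] at hw
    exact hw
  · intro h
    refine ⟨⟨?_, fun e he => ⟨fun t => η t * γ t, ?_, fun t _ => ?_⟩⟩, Units.ext h.init,
      fun t => ⟨η t * γ t, ?_, isLeftTranslate_units_iff.2 rfl⟩⟩
    · exact (isOpenEmbedding_unitsVal_of_cia A).isEmbedding.continuous_iff.2 h.continuous
    · exact (h.continuous.mul hγ).continuousOn
    · rw [(eq_of_mem_atlas_units he).1]
      exact h.deriv t
    · rw [chartAt_units]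
      exact h.deriv t

end UnitGroup

/-! ### The space of smooth curves as a parameter space -/

section SmoothCurves

variable {E : Type*} [AddCommGroup E] [Module ℝ E] [TopologicalSpace E]
  [IsTopologicalAddGroup E] [ContinuousSMul ℝ E]

/-- The inclusion of the smooth curves into all curves, as a linear map. -/
def SmoothCurve.toFunₗ : SmoothCurve E →ₗ[ℝ] (I → E) where
  toFun γ := γ.toCurve
  map_add' _ _ := rfl
  map_smul' _ _ := rfl

theorem SmoothCurve.continuous_toCurve : Continuous (SmoothCurve.toCurve (E := E)) := by
  have h : Continuous fun γ : SmoothCurve E => γ.iterDeriv 0 :=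
    (continuous_apply 0).comp continuous_induced_dom
  exact h.congr fun γ => γ.isDerivSeq.1

/-- Only the derivative of order zero is involved: the topology of `C^∞([0,1], E)` is finer than
that of uniform convergence, and the latter already controls the evolution. -/
theorem SmoothCurve.eventually_seminorm_lt (p : Seminorm ℝ E) (hp : Continuous p) (ε : ℝ)
    (hε : 0 < ε) : ∀ᶠ γ : SmoothCurve E in 𝓝 0, ∀ t, p (γ.toFunₗ t) < ε := by
  have h := (SmoothCurve.continuous_toCurve (E := E)).tendsto 0 |>.eventually
    (ContinuousMap.eventually_mapsTo isCompact_univ (isOpen_lt hp (continuous_const (y := ε)))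
      fun t _ => show p ((0 : C(I, E)) t) < ε by simpa using hε)
  exact h.mono fun γ hγ t => hγ (mem_univ t)

theorem SmoothCurve.isLipschitzCurve [LocallyConvexSpace ℝ E] (γ : SmoothCurve E) :
    IsLipschitzCurve γ.toFunₗ := by
  have h : ∀ t, HasCurveDerivAt γ.toCurve (γ.iterDeriv 1 t) t := by
    have := γ.isDerivSeq.2 0
    rwa [γ.isDerivSeq.1] at this
  refine isLipschitzCurve_of_hasCurveDerivAt h fun p hp => ?_
  obtain ⟨K, -, hK⟩ := exists_seminorm_curve_le (γ.iterDeriv 1).continuous hp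
  exact ⟨K, hK⟩

end SmoothCurves

/-! ### Milnor regularity of the unit group -/

theorem mainTheorem1 {𝕜 : Type*} [RCLike 𝕜] {A : Type*} [Ring A] [Algebra 𝕜 A]
    [Algebra ℝ A] [IsScalarTower ℝ 𝕜 A] [TopologicalSpace A] [T2Space A] [IsTopologicalRing A]
    [ContinuousSMul 𝕜 A] [ContinuousSMul ℝ A] [LocallyConvexSpace ℝ A]
    [IsContinuousInverseAlgebra A]
    (hA : IsMackeyComplete A) (hstar : ConditionStar 𝕜 A) :
    IsRegularLieGroup A Aˣ := by
  have hm := hstar.isLocallyMConvex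
  have hex : ∀ γ : SmoothCurve A, ∃ η : I → Aˣ, IsEvolution γ.toCurve η := by
    intro γ
    obtain ⟨η, hη⟩ := hA.exists_isLeftEvolution hm γ.isLipschitzCurve
    exact ⟨fun t => (hη.isUnit hA hm γ.isLipschitzCurve t).unit,
      (isEvolution_units_iff γ.toCurve.continuous).2 hη⟩
  refine ⟨isLCLieGroup_units, hex, ?_⟩
  choose η hη using hex
  have hη' := fun γ => (isEvolution_units_iff (SmoothCurve.toCurve γ).continuous).1 (hη γ)
  have hsmooth : ∀ n, ContDirDiffOn A n (fun γ => (η γ 1 : A)) univ := fun n =>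
    contDirDiffOn_evolution n hA hm SmoothCurve.toFunₗ SmoothCurve.isLipschitzCurve
      SmoothCurve.eventually_seminorm_lt fun γ => ⟨_, hη' γ, rfl⟩
  refine ⟨fun γ => η γ 1, fun γ ζ hζ => ?_, ?_, fun e he => ?_⟩
  · have h := (hη' γ).unique hm γ.toCurve.continuous
      ((isEvolution_units_iff γ.toCurve.continuous).1 hζ)
    exact Units.ext (congrFun h 1)
  · rw [(isOpenEmbedding_unitsVal_of_cia A).isEmbedding.continuous_iff]
    exact continuousOn_univ.1 (hsmooth 0)
  · obtain ⟨h1, h2, -⟩ := eq_of_mem_atlas_units he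
    rw [h1, h2, preimage_univ]
    exact smoothOnOpen_of_contDirDiffOn isOpen_univ hsmooth
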